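/- All rings are commutative and Noetherian with unity. Let $(R,\mathfrak m)$ be a Noetherian local ring that is equidimensional ($\dim R/\mathfrak p=\dim R$ for every minimal prime $\mathfrak p$ of $R$) and universally catenary, let $I\subseteq \mathfrak m$ be an ideal, and let $i\ge 0$ be an integer. Write $R[It,t^{-1}]=\bigoplus_{n\in\mathbb Z} I^n t^n\subseteq R[t,t^{-1}]$ for the extended Rees algebra (with $I^n=R$ for $n\le 0$) and $\operatorname{gr}_I(R)=\bigoplus_{n\ge 0} I^n/I^{n+1}$ for the associated graded ring. A Noetherian ring $A$ satisfies Serre's condition $(S_i)$ if $\operatorname{depth} A_p\ge \min\{i,\dim A_p\}$ for every prime ideal $p$ of $A$, and Serre's condition $(R_i)$ if $A_p$ is regular for every prime ideal $p$ of $A$ with $\dim A_p\le i$. Then: (1) if $\operatorname{gr}_I(R)$ satisfies $(S_i)$, then $R[It,t^{-1}]$ satisfies $(S_i)$; (2) if $\operatorname{gr}_I(R)$ satisfies $(R_i)$, then $R[It,t^{-1}]$ satisfies $(R_i)$; (3) if $R[It,t^{-1}]$ satisfies $(S_i)$, then $R$ satisfies $(S_i)$. -/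

import Mathlib

open scoped DirectSum LaurentPolynomial

universe u

noncomputable section

/-! ### The extended Rees algebra -/

/-- The extended Rees algebra `R[It, t⁻¹] = ⨁_{n ∈ ℤ} I ^ n t ^ n` inside `R[t, t⁻¹]`,
where `I ^ n = R` for `n ≤ 0`. -/
def extendedReesAlgebra {R : Type u} [CommRing R] (I : Ideal R) : Subalgebra R R[T;T⁻¹] where
  carrier := { f | ∀ n : ℤ, f.coeff n ∈ I ^ n.toNat }
  mul_mem' {f g} hf hg n := by
    classical
    rw [AddMonoidAlgebra.coeff_mul]
    simp only [Finsupp.sum]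
    refine Ideal.sum_mem _ fun i _ => Ideal.sum_mem _ fun j _ => ?_
    split_ifs with h
    · subst h
      have hle : (i + j).toNat ≤ i.toNat + j.toNat := by omega
      refine Ideal.pow_le_pow_right hle ?_
      rw [pow_add]
      exact Ideal.mul_mem_mul (hf i) (hg j)
    · exact Ideal.zero_mem _
  add_mem' {f g} hf hg n := by
    rw [AddMonoidAlgebra.coeff_add, Finsupp.add_apply]
    exact Ideal.add_mem _ (hf n) (hg n)
  algebraMap_mem' r n := by
    classical
    rw [LaurentPolynomial.algebraMap_apply, ← LaurentPolynomial.single_eq_C,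
      AddMonoidAlgebra.coeff_single, Finsupp.single_apply]
    split_ifs with h
    · subst h
      simp
    · exact Ideal.zero_mem _

/-! ### The associated graded ring -/

namespace AssocGraded

variable {R : Type u} [CommRing R] (I : Ideal R)

/-- The graded piece `I ^ n / I ^ (n + 1)`. -/
abbrev Piece (n : ℕ) : Type u := ↥(I ^ n) ⧸ (I ^ (n + 1)).submoduleOf (I ^ n)

/-- The class of an element of `I ^ n` in `I ^ n / I ^ (n + 1)`. -/
abbrev cls (n : ℕ) : ↥(I ^ n) →ₗ[R] Piece I n := ((I ^ (n + 1)).submoduleOf (I ^ n)).mkQ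

/-- The multiplication `I ^ m × I ^ n → I ^ (m + n)`. -/
def powMul (m n : ℕ) : ↥(I ^ m) →ₗ[R] ↥(I ^ n) →ₗ[R] ↥(I ^ (m + n)) :=
  LinearMap.mk₂ R
    (fun a b => ⟨(a : R) * (b : R), by rw [pow_add]; exact Ideal.mul_mem_mul a.2 b.2⟩)
    (fun _ _ _ => Subtype.ext (add_mul _ _ _))
    (fun _ _ _ => Subtype.ext (mul_assoc _ _ _))
    (fun _ _ _ => Subtype.ext (mul_add _ _ _))
    (fun _ _ _ => Subtype.ext (mul_left_comm _ _ _))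

@[simp] theorem coe_powMul (m n : ℕ) (a : ↥(I ^ m)) (b : ↥(I ^ n)) :
    (powMul I m n a b : R) = (a : R) * (b : R) := rfl

/-- The multiplication `I ^ m / I ^ (m + 1) × I ^ n / I ^ (n + 1) → I ^ (m + n) / I ^ (m + n + 1)`,
induced by the multiplication of `R`. -/
def pieceMul (m n : ℕ) : Piece I m →ₗ[R] Piece I n →ₗ[R] Piece I (m + n) :=
  Submodule.liftQ _
    { toFun := fun a => Submodule.mapQ _ _ (powMul I m n a) (by
        intro b hb
        have hb' : (b : R) ∈ I ^ (n + 1) := hb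
        change (a : R) * (b : R) ∈ I ^ (m + n + 1)
        rw [add_assoc, pow_add]
        exact Ideal.mul_mem_mul a.2 hb')
      map_add' := fun a b => by ext x; simp
      map_smul' := fun r a => by ext x; simp }
    (by
      intro a ha
      have ha' : (a : R) ∈ I ^ (m + 1) := ha
      rw [LinearMap.mem_ker]
      ext b
      simp only [LinearMap.coe_comp, Function.comp_apply, Submodule.mkQ_apply, LinearMap.coe_mk,
        AddHom.coe_mk, Submodule.mapQ_apply, LinearMap.zero_apply]
      rw [Submodule.Quotient.mk_eq_zero]
      change (a : R) * (b : R) ∈ I ^ (m + n + 1)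
      rw [show m + n + 1 = (m + 1) + n by omega, pow_add]
      exact Ideal.mul_mem_mul ha' b.2)

@[simp] theorem pieceMul_cls (m n : ℕ) (a : ↥(I ^ m)) (b : ↥(I ^ n)) :
    pieceMul I m n (cls I m a) (cls I n b) = cls I (m + n) (powMul I m n a b) := rfl

theorem mk_cls_eq {m n : ℕ} (h : m = n) (a : ↥(I ^ m)) (b : ↥(I ^ n)) (hab : (a : R) = b) :
    (GradedMonoid.mk m (cls I m a) : GradedMonoid (Piece I)) = GradedMonoid.mk n (cls I n b) := by
  subst h
  rw [Subtype.ext hab]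

/-- The class of `r` in `I ^ 0 / I ^ 1 = R / I`. -/
def cls₀ (r : R) : Piece I 0 := cls I 0 ⟨r, by simp⟩

instance : GradedMonoid.GMul (Piece I) := ⟨fun {m n} a b => pieceMul I m n a b⟩

instance : GradedMonoid.GOne (Piece I) := ⟨cls₀ I 1⟩

instance : DirectSum.GCommRing (Piece I) where
  mul_zero _ := map_zero _
  zero_mul _ := by
    change pieceMul I _ _ 0 _ = 0
    simp
  mul_add _ _ _ := map_add _ _ _
  add_mul _ _ _ := by
    change pieceMul I _ _ (_ + _) _ = pieceMul I _ _ _ _ + pieceMul I _ _ _ _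
    simp
  one_mul := by
    rintro ⟨n, a⟩
    obtain ⟨a, rfl⟩ := Submodule.mkQ_surjective _ a
    exact mk_cls_eq I (zero_add n) _ _ (one_mul _)
  mul_one := by
    rintro ⟨n, a⟩
    obtain ⟨a, rfl⟩ := Submodule.mkQ_surjective _ a
    exact mk_cls_eq I (add_zero n) _ _ (mul_one _)
  mul_assoc := by
    rintro ⟨m, a⟩ ⟨n, b⟩ ⟨k, c⟩
    obtain ⟨a, rfl⟩ := Submodule.mkQ_surjective _ a
    obtain ⟨b, rfl⟩ := Submodule.mkQ_surjective _ b
    obtain ⟨c, rfl⟩ := Submodule.mkQ_surjective _ c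
    exact mk_cls_eq I (add_assoc m n k) _ _ (mul_assoc _ _ _)
  mul_comm := by
    rintro ⟨m, a⟩ ⟨n, b⟩
    obtain ⟨a, rfl⟩ := Submodule.mkQ_surjective _ a
    obtain ⟨b, rfl⟩ := Submodule.mkQ_surjective _ b
    exact mk_cls_eq I (add_comm m n) _ _ (mul_comm _ _)
  natCast k := cls₀ I k
  natCast_zero := by
    change cls I 0 _ = 0
    rw [← map_zero (cls I 0)]
    congr 1
    exact Subtype.ext Nat.cast_zero
  natCast_succ k := by
    change cls I 0 _ = cls I 0 _ + cls I 0 _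
    rw [← map_add (cls I 0)]
    congr 1
    exact Subtype.ext (Nat.cast_succ k)
  intCast k := cls₀ I k
  intCast_ofNat k := by
    change cls I 0 _ = cls I 0 _
    congr 1
    exact Subtype.ext (Int.cast_natCast k)
  intCast_negSucc_ofNat k := by
    change cls I 0 _ = - cls I 0 _
    rw [← map_neg (cls I 0)]
    congr 1
    exact Subtype.ext (Int.cast_negSucc k)

end AssocGraded

/-- The associated graded ring `gr_I(R) = ⨁_{n ≥ 0} I ^ n / I ^ (n + 1)`. Its ring structure is
the one that Mathlib puts on a direct sum whose pieces have a graded multiplication. -/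
abbrev AssociatedGradedRing {R : Type u} [CommRing R] (I : Ideal R) : Type u :=
  ⨁ n : ℕ, AssocGraded.Piece I n

/-! ### Serre's conditions -/

/-- The depth of a local ring `A`: the supremum of the lengths of the `A`-regular sequences
in the maximal ideal. -/
def localDepth (A : Type u) [CommRing A] [IsLocalRing A] : ℕ∞ :=
  ⨆ (rs : List A) (_ : (∀ r ∈ rs, r ∈ IsLocalRing.maximalIdeal A) ∧
    RingTheory.Sequence.IsRegular A rs), (rs.length : ℕ∞)

/-- Serre's condition `(S_i)` for a Noetherian ring `A`:
`depth A_p ≥ min {i, dim A_p}` for all primes `p`. -/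
def SatisfiesS (i : ℕ) (A : Type u) [CommRing A] : Prop :=
  ∀ (p : Ideal A) [p.IsPrime],
    min (i : WithBot ℕ∞) (ringKrullDim (Localization.AtPrime p)) ≤
      (localDepth (Localization.AtPrime p) : WithBot ℕ∞)

/-- Serre's condition `(R_i)` for a Noetherian ring `A`:
`A_p` is regular for all primes `p` with `dim A_p ≤ i`. -/
def SatisfiesR (i : ℕ) (A : Type u) [CommRing A] : Prop :=
  ∀ (p : Ideal A) [p.IsPrime], ringKrullDim (Localization.AtPrime p) ≤ (i : WithBot ℕ∞) →
    IsRegularLocalRing (Localization.AtPrime p)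

/-! ### Equidimensional and universally catenary rings -/

/-- `A` is equidimensional: `dim A / p = dim A` for all minimal primes `p`. -/
def IsEquidimensionalRing (A : Type u) [CommRing A] : Prop :=
  ∀ p ∈ minimalPrimes A, ringKrullDim (A ⧸ p) = ringKrullDim A

/-- A Noetherian ring `A` is catenary: any two saturated chains of primes with the same
end points have the same length. -/
def IsCatenaryRing (A : Type u) [CommRing A] : Prop :=
  ∀ s t : RelSeries {(p, q) : PrimeSpectrum A × PrimeSpectrum A | p ⋖ q},
    s.head = t.head → s.last = t.last → s.length = t.length

/-- A Noetherian ring `A` is universally catenary: every finitely generated `A`-algebra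
is catenary. -/
def IsUniversallyCatenaryRing (A : Type u) [CommRing A] : Prop :=
  ∀ (B : Type u) [CommRing B] [Algebra A B], Algebra.FiniteType A B → IsCatenaryRing B

end

/-! Write `B` for the extended Rees algebra and `u = t⁻¹`. The element `u` is a nonzerodivisor, `B /
u = gr_I(R)`, and `B[u⁻¹] = R[t, t⁻¹]`. So `Spec B` splits into primes containing `u`, controlled by
`gr_I(R)`, and primes avoiding `u`, controlled by `R`.

If `u ∈ Q`, then `B_Q / u` is a localization of `gr_I(R)`. Dimension and depth both go up by one, so
`(S_i)` for `gr_I(R)` gives the local condition with index `i + 1` at `Q`; regularity lifts from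
`B_Q / u` to `B_Q` as well (`SerreLocal.of_surjective`, `IsRegularLocalRing.of_surjective`).

If `u ∉ P`, let `p = P ∩ R` and `p' = p R[t, t⁻¹] ∩ B`, so `p' ≤ P`. Both `B_P` and `B_{p'}` are
localizations of polynomial rings over `R_p`. The local conditions ascend from `R_p` to `B_P` and
descend from `B_{p'}` to `R_p` by flatness; the descent alone gives (3). For (1) and (2) it remains
to treat `p'`. Since `I ≤ m`, the ideal `p' + (u)` is proper; take a prime `Q` minimal over it. By
Krull's theorem `Q` covers `p'`.

For (1), localizing from `Q` to a prime it covers costs at most one in depth, which the surplus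
index `i + 1` pays for (`SerreLocal.localization_of_covBy`). For (2), one needs `ht Q ≤ ht p' + 1 ≤
i + 1`. Equidimensionality and universal catenarity give this by comparing saturated chains up to
the maximal homogeneous ideal (`height_le_height_add_one`). Then `B_Q` is regular, and so is its
localization `B_{p'}`. That last fact is Serre's theorem, proved here through finite projective
dimension (`IsRegularLocalRing.localization`). -/

section

open IsLocalRing

/-! ### Embedding dimension and regular local rings. -/

section RegularLocal

variable {A : Type u} [CommRing A] [IsLocalRing A] [IsNoetherianRing A]

/-- The class of `x` is nonzero in the cotangent space, so it extends to a basis. By Nakayama the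
basis lifts to minimal generators including `x`, and the others generate the maximal ideal modulo
`x`. -/
theorem spanFinrank_maximalIdeal_quotient_succ_le {x : A}
    (hx : x ∈ maximalIdeal A) (hx2 : x ∉ maximalIdeal A ^ 2)
    [IsLocalRing (A ⧸ Ideal.span {x})] :
    (maximalIdeal (A ⧸ Ideal.span {x})).spanFinrank + 1 ≤ (maximalIdeal A).spanFinrank := by
  classical
  let v : CotangentSpace A := (maximalIdeal A).toCotangent ⟨x, hx⟩
  have hv : v ≠ 0 := fun h => hx2 ((Ideal.toCotangent_eq_zero _ _).mp h)
  have hli : LinearIndepOn (ResidueField A) id ({v} : Set (CotangentSpace A)) :=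
    .singleton hv
  let B := Module.Basis.extend hli
  let b := hli.extend (Set.subset_univ _)
  have hvb : v ∈ b := hli.subset_extend _ rfl
  have hbfin : b.Finite := Set.toFinite _
  have hbcard : b.ncard = (maximalIdeal A).spanFinrank := by
    rw [spanFinrank_maximalIdeal_eq_finrank_cotangentSpace, Module.finrank_eq_nat_card_basis B]
    rfl
  have hbspan : Submodule.span (ResidueField A) b = ⊤ := hli.span_extend_eq_span _ |>.trans (by simp)
  choose g hg using (maximalIdeal A).toCotangent_surjective
  let s : Set (maximalIdeal A) := insert ⟨x, hx⟩ (g '' (b \ {v}))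
  have hs : (maximalIdeal A).toCotangent '' s = b := by
    rw [Set.image_insert_eq, ← Set.image_comp]
    have : ((maximalIdeal A).toCotangent ∘ g) = id := funext hg
    rw [this, Set.image_id, Set.insert_sdiff_singleton, Set.insert_eq_of_mem hvb]
  have hsp : Submodule.span A s = ⊤ := by
    rw [← CotangentSpace.span_image_eq_top_iff, hs, hbspan]
  have hm : maximalIdeal A = Ideal.span (Subtype.val '' s) := by
    have := congrArg (Submodule.map (maximalIdeal A).subtype) hsp
    rw [Submodule.map_span] at this
    simpa using this.symm
  let π := Ideal.Quotient.mk (Ideal.span {x})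
  have hmap : maximalIdeal (A ⧸ Ideal.span {x}) =
      Ideal.span (π '' (Subtype.val '' (g '' (b \ {v})))) := by
    have h1 : (maximalIdeal A).map π = maximalIdeal (A ⧸ Ideal.span {x}) := by
      have hloc : IsLocalHom π := IsLocalHom.of_surjective _ Ideal.Quotient.mk_surjective
      refine le_antisymm (((local_hom_TFAE π).out 0 2).mp hloc) ?_
      intro y hy
      obtain ⟨y, rfl⟩ := Ideal.Quotient.mk_surjective y
      refine Ideal.mem_map_of_mem _ ?_
      by_contra h
      exact hy ((not_not.mp h : IsUnit y).map π)
    rw [← h1]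
    refine (congrArg (Ideal.map π) hm).trans ?_
    rw [Ideal.map_span, Set.image_insert_eq, Set.image_insert_eq]
    have : π x = 0 := Ideal.Quotient.eq_zero_iff_mem.mpr (Ideal.mem_span_singleton_self x)
    simp only [this, Ideal.span_insert_zero]
  have hfin : (b \ {v}).Finite := hbfin.sdiff
  rw [hmap]
  refine (Nat.add_le_add_right (Submodule.spanFinrank_span_le_ncard_of_finite
    (((hfin.image _).image _).image _)) 1).trans ?_
  have h1 : (π '' (Subtype.val '' (g '' (b \ {v})))).ncard ≤ (b \ {v}).ncard :=
    (Set.ncard_image_le ((hfin.image _).image _)).trans <|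
      (Set.ncard_image_le (hfin.image _)).trans (Set.ncard_image_le hfin)
  have h2 := Set.ncard_sdiff_singleton_add_one hvb hbfin
  omega

theorem exists_mem_maximalIdeal_notMem_sq (h : maximalIdeal A ≠ ⊥) (S : Set (Ideal A))
    (hS : S.Finite) (hp : ∀ p ∈ S, p.IsPrime) (hm : ∀ p ∈ S, p ≠ maximalIdeal A) :
    ∃ x ∈ maximalIdeal A, x ∉ maximalIdeal A ^ 2 ∧ ∀ p ∈ S, x ∉ p := by
  classical
  by_contra! hcon
  have hsub : ((maximalIdeal A : Ideal A) : Set A) ⊆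
      ⋃ i ∈ ((insert (maximalIdeal A ^ 2) hS.toFinset : Finset (Ideal A)) : Set (Ideal A)),
        ((i : Ideal A) : Set A) := by
    intro x hx
    simp only [Finset.coe_insert, Set.Finite.coe_toFinset, Set.mem_insert_iff, Set.iUnion_iUnion_eq_or_left,
      Set.mem_union, SetLike.mem_coe, Set.mem_iUnion, exists_prop]
    by_cases h2 : x ∈ maximalIdeal A ^ 2
    · exact Or.inl h2
    · obtain ⟨p, hpS, hxp⟩ := hcon x hx h2
      exact Or.inr ⟨p, hpS, hxp⟩
  -- Prime avoidance tolerates two non-prime members; both exceptional slots are given to the square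
  -- of the maximal ideal, which Nakayama then rules out.
  obtain ⟨i, hi, hle⟩ := (Ideal.subset_union_prime (f := fun i : Ideal A => i)
    (maximalIdeal A ^ 2) (maximalIdeal A ^ 2) (by
      intro i hi h1 _
      rw [Finset.mem_insert] at hi
      exact hp i (by simpa using hi.resolve_left h1))).mp hsub
  rw [Finset.mem_insert] at hi
  rcases hi with rfl | hi
  · refine h (Submodule.eq_bot_of_le_smul_of_le_jacobson_bot (maximalIdeal A) _
      (IsNoetherian.noetherian _) ?_ (maximalIdeal_le_jacobson _))
    rwa [smul_eq_mul, ← sq]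
  · have hiS : i ∈ S := by simpa using hi
    exact hm i hiS ((maximalIdeal.isMaximal A).eq_of_le (hp i hiS).ne_top hle).symm

end RegularLocal

/-- The embedding dimension drops by at least one and the dimension by at most one, so equality
persists. This does not require knowing that `x` is regular, which matters because
`IsRegularLocalRing.isDomain` is deduced from it. -/
theorem IsRegularLocalRing.quotient_span_singleton {A : Type u} [CommRing A] [IsRegularLocalRing A] {x : A}
    (hx : x ∈ maximalIdeal A) (hx2 : x ∉ maximalIdeal A ^ 2) :
    IsRegularLocalRing (A ⧸ Ideal.span {x}) := by
  have hne : Ideal.span {x} ≠ ⊤ := fun h =>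
    (maximalIdeal.isMaximal A).ne_top (top_le_iff.mp (h ▸ (Ideal.span_singleton_le_iff_mem _).mpr hx))
  have : Nontrivial (A ⧸ Ideal.span {x}) := Ideal.Quotient.nontrivial_iff.mpr hne
  have : IsLocalRing (A ⧸ Ideal.span {x}) := .of_surjective' _ Ideal.Quotient.mk_surjective
  apply IsRegularLocalRing.of_spanFinrank_maximalIdeal_le
  have h1 := spanFinrank_maximalIdeal_quotient_succ_le hx hx2
  have h2 : ringKrullDim A ≤ ringKrullDim (A ⧸ Ideal.span {x}) + 1 := by
    have := ringKrullDim_le_ringKrullDim_quotSMulTop_succ hx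
    rwa [← Submodule.ideal_span_singleton_smul, smul_eq_mul, Ideal.mul_top] at this
  rw [← (isRegularLocalRing_iff A).mp inferInstance] at h2
  have h3 : (((maximalIdeal (A ⧸ Ideal.span {x})).spanFinrank : WithBot ℕ∞) + 1) ≤
      ringKrullDim (A ⧸ Ideal.span {x}) + 1 := le_trans (by exact_mod_cast h1) h2
  exact (ENat.WithBot.add_le_add_one_right_iff).mp h3

theorem IsRegularLocalRing.isDomain (A : Type u) [CommRing A] [IsRegularLocalRing A] :
    IsDomain A := by
  generalize hd : (maximalIdeal A).spanFinrank = d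
  induction d generalizing A with
  | zero =>
    have : maximalIdeal A = ⊥ :=
      (Submodule.spanFinrank_eq_zero_iff_eq_bot (IsNoetherian.noetherian _)).mp hd
    exact ((isField_iff_maximalIdeal_eq).mpr this).isDomain
  | succ d ih =>
    have hreg := (isRegularLocalRing_iff A).mp inferInstance
    have hmin : ∀ p ∈ minimalPrimes A, p ≠ maximalIdeal A := by
      rintro p hp rfl
      rw [hd, ← maximalIdeal_height_eq_ringKrullDim] at hreg
      rw [Ideal.height_eq_zero_iff.mpr (by simpa [minimalPrimes] using hp)] at hreg
      norm_cast at hreg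
    have hbot : maximalIdeal A ≠ ⊥ := fun h => by
      rw [h, Submodule.spanFinrank_bot] at hd
      omega
    obtain ⟨x, hx, hx2, hxp⟩ := exists_mem_maximalIdeal_notMem_sq hbot (minimalPrimes A)
      (minimalPrimes.finite_of_isNoetherianRing A) (fun p hp => hp.1.1) hmin
    have := IsRegularLocalRing.quotient_span_singleton hx hx2
    have h1 := spanFinrank_maximalIdeal_quotient_succ_le hx hx2
    have h2 : ringKrullDim A ≤ ringKrullDim (A ⧸ Ideal.span {x}) + 1 := by
      have := ringKrullDim_le_ringKrullDim_quotSMulTop_succ hx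
      rwa [← Submodule.ideal_span_singleton_smul, smul_eq_mul, Ideal.mul_top] at this
    rw [← hreg, ← (isRegularLocalRing_iff (A ⧸ Ideal.span {x})).mp inferInstance] at h2
    have h3 : (maximalIdeal A).spanFinrank ≤
      (maximalIdeal (A ⧸ Ideal.span {x})).spanFinrank + 1 := by exact_mod_cast h2
    have hdom := ih (A ⧸ Ideal.span {x}) (by omega)
    have hxprime : (Ideal.span {x}).IsPrime := (Ideal.Quotient.isDomain_iff_prime _).mp hdom
    obtain ⟨p, hp, hpx⟩ := Ideal.exists_minimalPrimes_le (bot_le : ⊥ ≤ Ideal.span {x})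
    have hpp : p.IsPrime := hp.1.1
    -- A minimal prime `p` inside the prime `(x)` does not contain `x`, hence `p = x p`, and
    -- Nakayama applies.
    have hp0 : p = ⊥ := by
      refine Submodule.eq_bot_of_le_smul_of_le_jacobson_bot (maximalIdeal A) _
        (IsNoetherian.noetherian _) ?_ (maximalIdeal_le_jacobson _)
      intro y hy
      obtain ⟨z, rfl⟩ := Ideal.mem_span_singleton'.mp (hpx hy)
      have hz := (hpp.mem_or_mem hy).resolve_right (hxp p hp)
      rw [mul_comm]
      exact Submodule.smul_mem_smul hx hz
    subst hp0
    exact IsDomain.of_bot_isPrime A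

end

/-! ### Projective dimension and change of rings modulo a regular element. -/

section

open IsLocalRing CategoryTheory Module

/-- `M` has projective dimension at most `n` over `A`. -/
abbrev HasProjDimLE (A : Type u) [CommRing A] (M : Type u) [AddCommGroup M] [Module A M]
    (n : ℕ) : Prop :=
  HasProjectiveDimensionLE (ModuleCat.of A M) n

section ProjDim

variable {A : Type u} [CommRing A] {L M N : Type u} [AddCommGroup L] [Module A L]
  [AddCommGroup M] [Module A M] [AddCommGroup N] [Module A N]

theorem HasProjDimLE.mono {m n : ℕ} (h : HasProjDimLE A M m) (hmn : m ≤ n) :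
    HasProjDimLE A M n :=
  hasProjectiveDimensionLT_of_ge _ (m + 1) (n + 1) (by omega)

theorem HasProjDimLE.of_linearEquiv {n : ℕ} (h : HasProjDimLE A M n) (e : M ≃ₗ[A] N) :
    HasProjDimLE A N n :=
  hasProjectiveDimensionLT_of_iso e.toModuleIso (n + 1)

theorem hasProjDimLE_zero_iff : HasProjDimLE A M 0 ↔ Module.Projective A M := by
  rw [IsProjective.iff_projective]
  exact (projective_iff_hasProjectiveDimensionLE_zero _).symm

theorem shortExact_of_linearMap {f : L →ₗ[A] M} {g : M →ₗ[A] N} (hf : Function.Injective f)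
    (hfg : Function.Exact f g) (hg : Function.Surjective g) :
    (ModuleCat.shortComplexOfCompEqZero f g
      (LinearMap.ext fun x => hfg.apply_apply_eq_zero x)).ShortExact where
  exact := ModuleCat.shortComplex_exact _ hfg
  mono_f := (ModuleCat.mono_iff_injective _).mpr hf
  epi_g := (ModuleCat.epi_iff_surjective _).mpr hg

theorem HasProjDimLE.of_exact_right {f : L →ₗ[A] M} {g : M →ₗ[A] N} (hf : Function.Injective f)
    (hfg : Function.Exact f g) (hg : Function.Surjective g) {n : ℕ}
    (hL : HasProjDimLE A L n) (hM : HasProjDimLE A M (n + 1)) : HasProjDimLE A N (n + 1) :=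
  (shortExact_of_linearMap hf hfg hg).hasProjectiveDimensionLT_X₃ (n + 1) hL hM

theorem HasProjDimLE.of_exact_left {f : L →ₗ[A] M} {g : M →ₗ[A] N} (hf : Function.Injective f)
    (hfg : Function.Exact f g) (hg : Function.Surjective g) {n : ℕ}
    (hM : HasProjDimLE A M n) (hN : HasProjDimLE A N (n + 1)) : HasProjDimLE A L n :=
  (shortExact_of_linearMap hf hfg hg).hasProjectiveDimensionLT_X₁ (n + 1) hM hN

theorem HasProjDimLE.of_retract {n : ℕ} (h : HasProjDimLE A M n) (i : N →ₗ[A] M)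
    (r : M →ₗ[A] N) (hir : ∀ x, r (i x) = x) : HasProjDimLE A N n :=
  Retract.hasProjectiveDimensionLT (X := ModuleCat.of A N) (Y := ModuleCat.of A M)
    ⟨ModuleCat.ofHom i, ModuleCat.ofHom r, by ext x; exact hir x⟩ (n + 1)

theorem exact_subtype_ker (f : M →ₗ[A] N) : Function.Exact (LinearMap.ker f).subtype f :=
  LinearMap.exact_subtype_ker_map f

end ProjDim

section ChangeOfRings

variable {A : Type u} [CommRing A] [IsLocalRing A] [IsNoetherianRing A] {x : A}

omit [IsNoetherianRing A] in
theorem isLocalRing_quotient_span_singleton (hx : x ∈ maximalIdeal A) :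
    IsLocalRing (A ⧸ Ideal.span {x}) := by
  have hne : Ideal.span {x} ≠ ⊤ := fun h =>
    (maximalIdeal.isMaximal A).ne_top (top_le_iff.mp (h ▸ (Ideal.span_singleton_le_iff_mem _).mpr hx))
  have : Nontrivial (A ⧸ Ideal.span {x}) := Ideal.Quotient.nontrivial_iff.mpr hne
  exact .of_surjective' _ Ideal.Quotient.mk_surjective

omit [IsLocalRing A] [IsNoetherianRing A] in
theorem hasProjDimLE_one_pi_quotient (hreg : IsSMulRegular A x) (k : ℕ) :
    HasProjDimLE A (Fin k → A ⧸ Ideal.span {x}) 1 := by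
  have h0 : HasProjDimLE A (Fin k → A) 0 := hasProjDimLE_zero_iff.mpr inferInstance
  refine HasProjDimLE.of_exact_right (f := LinearMap.lsmul A (Fin k → A) x)
    (g := LinearMap.compLeft (Ideal.Quotient.mkₐ A (Ideal.span {x})).toLinearMap (Fin k))
    (fun a b hab => funext fun i => hreg (congrFun hab i)) (fun a => ?_) (fun a => ?_) h0
    (h0.mono (by omega))
  · constructor
    · intro h
      have h1 : ∀ i, ∃ c, c * x = a i := fun i =>
        Ideal.mem_span_singleton'.mp (Ideal.Quotient.eq_zero_iff_mem.mp (congrFun h i))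
      choose c hc using h1
      exact ⟨c, funext fun i => (mul_comm _ _).trans (hc i)⟩
    · rintro ⟨c, rfl⟩
      refine funext fun i => Ideal.Quotient.eq_zero_iff_mem.mpr ?_
      exact Ideal.mem_span_singleton.mpr ⟨c i, rfl⟩
  · choose b hb using fun i => Ideal.Quotient.mk_surjective (a i)
    exact ⟨b, funext hb⟩

/-- Dimension shifting: finite projectives over the local ring `A / x` are free, and `A / x` has
projective dimension at most one over `A`. -/
theorem HasProjDimLE.restrictScalars_quotient (hx : x ∈ maximalIdeal A)
    (hreg : IsSMulRegular A x) {M : Type u} [AddCommGroup M] [Module A M]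
    [Module (A ⧸ Ideal.span {x}) M] [IsScalarTower A (A ⧸ Ideal.span {x}) M]
    [Module.Finite (A ⧸ Ideal.span {x}) M] {n : ℕ} (h : HasProjDimLE (A ⧸ Ideal.span {x}) M n) :
    HasProjDimLE A M (n + 1) := by
  have := isLocalRing_quotient_span_singleton hx
  induction n generalizing M with
  | zero =>
    rw [hasProjDimLE_zero_iff] at h
    have : Module.Free (A ⧸ Ideal.span {x}) M := Module.free_of_flat_of_isLocalRing
    exact (hasProjDimLE_one_pi_quotient hreg _).of_linearEquiv
      ((Module.finBasis (A ⧸ Ideal.span {x}) M).equivFun.symm.restrictScalars A)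
  | succ n ih =>
    obtain ⟨k, f, hf⟩ := Module.Finite.exists_fin' (A ⧸ Ideal.span {x}) M
    have hK := ih (M := LinearMap.ker f) (HasProjDimLE.of_exact_left
      (LinearMap.ker f).injective_subtype (exact_subtype_ker f) hf
      ((hasProjDimLE_zero_iff.mpr inferInstance : HasProjDimLE (A ⧸ Ideal.span {x})
        (Fin k → A ⧸ Ideal.span {x}) 0).mono (by omega)) h)
    exact HasProjDimLE.of_exact_right (f := (LinearMap.ker f).subtype.restrictScalars A)
      (g := f.restrictScalars A) (LinearMap.ker f).injective_subtype (exact_subtype_ker f) hf hK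
      ((hasProjDimLE_one_pi_quotient hreg k).mono (by omega))

omit [IsLocalRing A] in
-- A syzygy sequence stays exact on the left modulo `x` because `x` is regular on `M`, so a
-- projective resolution over `A` reduces to one over `A / x`.
theorem HasProjDimLE.quotSMulTop (hreg : IsSMulRegular A x) {M : Type u} [AddCommGroup M]
    [Module A M] [Module.Finite A M] (hM : IsSMulRegular M x) {n : ℕ} (h : HasProjDimLE A M n) :
    HasProjDimLE (A ⧸ Ideal.span {x}) (QuotSMulTop x M) n := by
  have hproj : ∀ (P : Type u) [AddCommGroup P] [Module A P], Module.Projective A P →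
      HasProjDimLE (A ⧸ Ideal.span {x}) (QuotSMulTop x P) 0 := by
    intro P _ _ hP
    rw [hasProjDimLE_zero_iff]
    exact Module.Projective.of_equiv ((QuotSMulTop.equivQuotTensor x P).extendScalarsOfSurjective
      Ideal.Quotient.mk_surjective).symm
  induction n generalizing M with
  | zero => exact hproj M (hasProjDimLE_zero_iff.mp h)
  | succ n ih =>
    obtain ⟨k, f, hf⟩ := Module.Finite.exists_fin' A M
    have hP : IsSMulRegular (Fin k → A) x := fun a b hab => funext fun i => hreg (congrFun hab i)
    have hK : IsSMulRegular (LinearMap.ker f) x :=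
      hP.of_injective (LinearMap.ker f).subtype (LinearMap.ker f).injective_subtype
    have hK2 := ih hK (HasProjDimLE.of_exact_left
      (LinearMap.ker f).injective_subtype (exact_subtype_ker f) hf
      ((hasProjDimLE_zero_iff.mpr inferInstance : HasProjDimLE A (Fin k → A) 0).mono
        (by omega)) h)
    have hinj : Function.Injective (QuotSMulTop.map x (LinearMap.ker f).subtype) := by
      have h1 : Function.Exact (0 : PUnit.{u+1} →ₗ[A] LinearMap.ker f)
          (LinearMap.ker f).subtype := by
        intro y
        constructor
        · intro hy
          exact ⟨0, ((LinearMap.ker f).injective_subtype (hy.trans (map_zero _).symm)).symm⟩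
        · rintro ⟨_, rfl⟩
          simp
      have h2 := QuotSMulTop.map_first_exact_on_four_term_exact_of_isSMulRegular_last (r := x) h1
        (exact_subtype_ker f) hM
      rw [injective_iff_map_eq_zero]
      intro a ha
      obtain ⟨b, rfl⟩ := (h2 a).mp ha
      simp
    exact HasProjDimLE.of_exact_right
      (f := (QuotSMulTop.map x (LinearMap.ker f).subtype).extendScalarsOfSurjective
        Ideal.Quotient.mk_surjective)
      (g := (QuotSMulTop.map x f).extendScalarsOfSurjective Ideal.Quotient.mk_surjective) hinj
      (QuotSMulTop.map_exact x (exact_subtype_ker f) hf) (QuotSMulTop.map_surjective x hf) hK2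
      ((hproj _ inferInstance).mono (by omega))

end ChangeOfRings

/-- Induction on embedding dimension. Replacing `M` by a syzygy `K` makes `x` regular on it. The
induction hypothesis handles `K / xK` over `A / x`, hence over `A`, and its projective dimension
over `A` is one more than that of `K`. -/
theorem IsRegularLocalRing.exists_hasProjDimLE (A : Type u) [CommRing A] [IsRegularLocalRing A]
    (M : Type u) [AddCommGroup M] [Module A M] [Module.Finite A M] : ∃ n, HasProjDimLE A M n := by
  generalize hd : (maximalIdeal A).spanFinrank = d
  induction d generalizing A M with
  | zero =>
    have : maximalIdeal A = ⊥ :=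
      (Submodule.spanFinrank_eq_zero_iff_eq_bot (IsNoetherian.noetherian _)).mp hd
    let := ((isField_iff_maximalIdeal_eq).mpr this).toField
    exact ⟨0, hasProjDimLE_zero_iff.mpr inferInstance⟩
  | succ d ih =>
    have hbot : maximalIdeal A ≠ ⊥ := fun h => by
      rw [h, Submodule.spanFinrank_bot] at hd
      omega
    have hdom := IsRegularLocalRing.isDomain A
    obtain ⟨x, hx, hx2, -⟩ := exists_mem_maximalIdeal_notMem_sq hbot ∅ (by simp) (by simp) (by simp)
    have hx0 : x ≠ 0 := fun h => hx2 (h ▸ zero_mem _)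
    have hreg : IsSMulRegular A x := fun a b hab => mul_left_cancel₀ hx0 hab
    have := IsRegularLocalRing.quotient_span_singleton hx hx2
    have h1 := spanFinrank_maximalIdeal_quotient_succ_le hx hx2
    have h2 := ringKrullDim_quotient_span_singleton_succ_eq_ringKrullDim hreg hx
    rw [← (isRegularLocalRing_iff A).mp inferInstance,
      ← (isRegularLocalRing_iff (A ⧸ Ideal.span {x})).mp inferInstance] at h2
    have h3 : (maximalIdeal (A ⧸ Ideal.span {x})).spanFinrank + 1 =
      (maximalIdeal A).spanFinrank := by exact_mod_cast h2
    obtain ⟨k, f, hf⟩ := Module.Finite.exists_fin' A M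
    have hP : IsSMulRegular (Fin k → A) x := fun a b hab => funext fun i => hreg (congrFun hab i)
    have hK : IsSMulRegular (LinearMap.ker f) x :=
      hP.of_injective (LinearMap.ker f).subtype (LinearMap.ker f).injective_subtype
    have : Module.Finite (A ⧸ Ideal.span {x}) (QuotSMulTop x (LinearMap.ker f)) :=
      Module.Finite.of_restrictScalars_finite A _ _
    obtain ⟨n, hn⟩ := ih (A ⧸ Ideal.span {x}) (QuotSMulTop x (LinearMap.ker f)) (by omega)
    have hn2 := hn.restrictScalars_quotient hx hreg
    have hpd := ModuleCat.projectiveDimension_quotSMulTop_eq_succ_of_isSMulRegular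
      (ModuleCat.of A (LinearMap.ker f)) x hK hx
    have hK3 : HasProjDimLE A (LinearMap.ker f) n := by
      rw [HasProjDimLE, ← projectiveDimension_le_iff] at hn2 ⊢
      rw [hpd] at hn2
      push_cast at hn2
      exact ENat.WithBot.add_le_add_one_right_iff.mp hn2
    exact ⟨n + 1, HasProjDimLE.of_exact_right (LinearMap.ker f).injective_subtype
      (exact_subtype_ker f) hf hK3
      ((hasProjDimLE_zero_iff.mpr inferInstance : HasProjDimLE A (Fin k → A) 0).mono (by omega))⟩

end

/-! ### The homological criterion for regularity, and localization of regular rings. -/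

section

open IsLocalRing CategoryTheory Module

section DepthZero

variable {A : Type u} [CommRing A] [IsLocalRing A]

theorem exists_surjective_pi_ker_le (M : Type u) [AddCommGroup M] [Module A M]
    [Module.Finite A M] : ∃ (k : ℕ) (f : (Fin k → A) →ₗ[A] M), Function.Surjective f ∧
      ∀ z ∈ LinearMap.ker f, ∀ i, z i ∈ maximalIdeal A := by
  classical
  have hex : ∃ k : ℕ, ∃ f : (Fin k → A) →ₗ[A] M, Function.Surjective f :=
    Module.Finite.exists_fin' A M
  obtain ⟨f, hf⟩ := Nat.find_spec hex
  have hmin : ∀ m < Nat.find hex, ¬ _ := fun m hm => Nat.find_min hex hm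
  generalize Nat.find hex = k at f hmin
  refine ⟨k, f, hf, fun z hz i => ?_⟩
  by_contra hzi
  have hu : IsUnit (z i) := not_not.mp hzi
  obtain ⟨u, hu⟩ := hu
  obtain _ | k := k
  · exact i.elim0
  · refine hmin k (Nat.lt_succ_self k)
      -- A relation with unit coefficient at `i` makes the `i`-th generator redundant: `w'`
      -- subtracts the multiple of the relation that clears this coordinate. This contradicts
      -- minimality of `k`.
      ⟨f ∘ₗ Function.ExtendByZero.linearMap A i.succAbove, fun y => ?_⟩
    obtain ⟨w, rfl⟩ := hf y
    let w' := w - (w i * ↑u⁻¹) • z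
    have hw' : w' i = 0 := by simp [w', ← hu]
    refine ⟨fun j => w' (i.succAbove j), ?_⟩
    have h1 : Function.ExtendByZero.linearMap A i.succAbove (fun j => w' (i.succAbove j)) = w' := by
      funext j
      rw [Function.ExtendByZero.linearMap_apply]
      rcases Fin.eq_self_or_eq_succAbove i j with rfl | ⟨j, rfl⟩
      · rw [hw', Function.extend_apply']
        · rfl
        · rintro ⟨a, ha⟩
          exact Fin.succAbove_ne _ _ ha
      · rw [Fin.succAbove_right_injective.extend_apply]
    rw [LinearMap.comp_apply, h1, map_sub, map_smul, LinearMap.mem_ker.mp hz, smul_zero, sub_zero]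

variable [IsNoetherianRing A]

/-- The depth-zero case of Auslander–Buchsbaum. The syzygy of a minimal cover has coordinates in the
maximal ideal, so `s` kills it; being free by induction, it must vanish. -/
theorem HasProjDimLE.free_of_socle {s : A} (hs : s ≠ 0) (hsm : ∀ a ∈ maximalIdeal A, s * a = 0)
    {M : Type u} [AddCommGroup M] [Module A M] [Module.Finite A M] {n : ℕ}
    (h : HasProjDimLE A M n) : Module.Free A M := by
  induction n generalizing M with
  | zero =>
    have := hasProjDimLE_zero_iff.mp h
    exact Module.free_of_flat_of_isLocalRing
  | succ n ih =>
    obtain ⟨k, f, hf, hker⟩ := exists_surjective_pi_ker_le (A := A) M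
    have hK := ih (HasProjDimLE.of_exact_left (LinearMap.ker f).injective_subtype
      (exact_subtype_ker f) hf ((hasProjDimLE_zero_iff.mpr inferInstance :
        HasProjDimLE A (Fin k → A) 0).mono (by omega)) h)
    have hzero : ∀ z : LinearMap.ker f, s • z = 0 := fun z =>
      Subtype.ext (funext fun i => hsm _ (hker z.1 z.2 i))
    have hsub : Subsingleton (LinearMap.ker f) := by
      by_contra hns
      rw [not_subsingleton_iff_nontrivial] at hns
      let b := Module.Free.chooseBasis A (LinearMap.ker f)
      have : Nonempty (Module.Free.ChooseBasisIndex A (LinearMap.ker f)) := b.index_nonempty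
      obtain ⟨i⟩ := this
      have h1 := congrArg (fun v => b.repr v i) (hzero (b i))
      simp at h1
      exact hs h1
    have hinj : Function.Injective f := LinearMap.ker_eq_bot.mp
      ((Submodule.subsingleton_iff_eq_bot).mp hsub)
    exact Module.Free.of_equiv (LinearEquiv.ofBijective f ⟨hinj, hf⟩)

end DepthZero

section Converse

variable {A : Type u} [CommRing A] [IsLocalRing A] [IsNoetherianRing A]

theorem exists_cotangent_functional {x : A} (hx : x ∈ maximalIdeal A)
    (hx2 : x ∉ maximalIdeal A ^ 2) :
    ∃ φ : maximalIdeal A →ₗ[A] ResidueField A, φ ⟨x, hx⟩ = 1 := by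
  let v : CotangentSpace A := (maximalIdeal A).toCotangent ⟨x, hx⟩
  have hv : v ≠ 0 := fun h => hx2 ((Ideal.toCotangent_eq_zero _ _).mp h)
  obtain ⟨g, hg⟩ : ∃ g : Module.Dual (ResidueField A) (CotangentSpace A), g v ≠ 0 := by
    by_contra! hcon
    exact hv ((Module.forall_dual_apply_eq_zero_iff (ResidueField A) v).mp hcon)
  refine ⟨((((g v)⁻¹ • g).restrictScalars A)) ∘ₗ (maximalIdeal A).toCotangent, ?_⟩
  exact inv_mul_cancel₀ hg

/-- With `m` the maximal ideal, the surjection from `m / xm` to the maximal ideal of `A / x` has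
kernel spanned by the class of `x`. A functional on the cotangent space with value one at `x` splits
this kernel off, so the target is a retract of `m / xm`. -/
theorem HasProjDimLE.maximalIdeal_quotient {x : A} (hx : x ∈ maximalIdeal A)
    (hx2 : x ∉ maximalIdeal A ^ 2) (hreg : IsSMulRegular A x)
    [IsLocalRing (A ⧸ Ideal.span {x})] {n : ℕ} (h : HasProjDimLE A (maximalIdeal A) n) :
    HasProjDimLE (A ⧸ Ideal.span {x}) (maximalIdeal (A ⧸ Ideal.span {x})) n := by
  obtain ⟨φ, hφ⟩ := exists_cotangent_functional hx hx2
  have hregm : IsSMulRegular (maximalIdeal A) x :=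
    hreg.of_injective (maximalIdeal A).subtype (maximalIdeal A).injective_subtype
  have hq := HasProjDimLE.quotSMulTop hreg hregm h
  let π := Ideal.Quotient.mk (Ideal.span {x})
  have hloc : IsLocalHom π := IsLocalHom.of_surjective _ Ideal.Quotient.mk_surjective
  have hπ : ∀ a, π a ∈ maximalIdeal (A ⧸ Ideal.span {x}) ↔ a ∈ maximalIdeal A := fun a =>
    map_mem_nonunits_iff π a
  let ρ₀ : maximalIdeal A →ₗ[A] maximalIdeal (A ⧸ Ideal.span {x}) :=
    { toFun := fun a => ⟨π a, (hπ a).mpr a.2⟩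
      map_add' := fun a b => Subtype.ext (map_add π _ _)
      map_smul' := fun r a => Subtype.ext (map_mul π _ _) }
  have hρ₀ : Function.Surjective ρ₀ := by
    rintro ⟨y, hy⟩
    obtain ⟨a, rfl⟩ := Ideal.Quotient.mk_surjective y
    exact ⟨⟨a, (hπ a).mp hy⟩, rfl⟩
  have hxx : ∀ a : A, π (x * a) = 0 := fun a =>
    Ideal.Quotient.eq_zero_iff_mem.mpr (Ideal.mem_span_singleton.mpr ⟨a, rfl⟩)
  let ρ : QuotSMulTop x (maximalIdeal A) →ₗ[A] maximalIdeal (A ⧸ Ideal.span {x}) :=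
    Submodule.liftQ _ ρ₀ (by
      rintro _ ⟨a, -, rfl⟩
      exact Subtype.ext (hxx a))
  let q : maximalIdeal A →ₗ[A] QuotSMulTop x (maximalIdeal A) := Submodule.mkQ _
  let j : ResidueField A →ₗ[A] QuotSMulTop x (maximalIdeal A) :=
    Submodule.liftQ (maximalIdeal A) (LinearMap.toSpanSingleton A _ (q ⟨x, hx⟩)) (by
      intro a ha
      rw [LinearMap.mem_ker, LinearMap.toSpanSingleton_apply, ← map_smul]
      refine (Submodule.Quotient.mk_eq_zero _).mpr ⟨⟨a, ha⟩, trivial, ?_⟩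
      exact Subtype.ext (mul_comm x a))
  have hj : ∀ a : A, j (IsLocalRing.residue A a) = a • q ⟨x, hx⟩ := fun a => rfl
  have hρj : ∀ c, ρ (j c) = 0 := by
    intro c
    obtain ⟨c, rfl⟩ := IsLocalRing.residue_surjective c
    rw [hj, map_smul]
    have : ρ (q ⟨x, hx⟩) = 0 := Subtype.ext ((congrArg π (mul_one x)).symm.trans (hxx 1))
    rw [this, smul_zero]
  -- Subtracting the component along `x` makes the map vanish on multiples of `x`, so it factors
  -- through the maximal ideal of `A / x` and gives the section.
  let σ₀ : maximalIdeal A →ₗ[A] QuotSMulTop x (maximalIdeal A) := q - j ∘ₗ φ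
  have hσ₀ : LinearMap.ker ρ₀ ≤ LinearMap.ker σ₀ := by
    intro a ha
    have h1 : π (a : A) = 0 := congrArg Subtype.val (LinearMap.mem_ker.mp ha)
    obtain ⟨b, hb⟩ := Ideal.mem_span_singleton'.mp (Ideal.Quotient.eq_zero_iff_mem.mp h1)
    have h2 : a = b • (⟨x, hx⟩ : maximalIdeal A) := Subtype.ext hb.symm
    rw [LinearMap.mem_ker, h2, map_smul]
    have h3 : σ₀ ⟨x, hx⟩ = 0 := by
      have : (1 : ResidueField A) = IsLocalRing.residue A 1 := (map_one _).symm
      simp only [σ₀, LinearMap.sub_apply, LinearMap.comp_apply, hφ]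
      rw [this, hj, one_smul, sub_self]
    rw [h3, smul_zero]
  let σ : maximalIdeal (A ⧸ Ideal.span {x}) →ₗ[A] QuotSMulTop x (maximalIdeal A) :=
    (Submodule.liftQ _ σ₀ hσ₀) ∘ₗ (ρ₀.quotKerEquivOfSurjective hρ₀).symm.toLinearMap
  have hσρ : ∀ a, σ (ρ₀ a) = σ₀ a := by
    intro a
    have : (ρ₀.quotKerEquivOfSurjective hρ₀).symm (ρ₀ a) = Submodule.Quotient.mk a := by
      rw [LinearEquiv.symm_apply_eq]
      rfl
    simp only [σ, LinearMap.comp_apply, LinearEquiv.coe_coe, this]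
    rfl
  refine HasProjDimLE.of_retract hq (σ.extendScalarsOfSurjective Ideal.Quotient.mk_surjective)
    (ρ.extendScalarsOfSurjective Ideal.Quotient.mk_surjective) fun y => ?_
  obtain ⟨a, rfl⟩ := hρ₀ y
  change ρ (σ (ρ₀ a)) = ρ₀ a
  rw [hσρ]
  simp only [σ₀, LinearMap.sub_apply, LinearMap.comp_apply, map_sub, hρj, sub_zero]
  rfl

end Converse

theorem spanFinrank_maximalIdeal_le_quotient_succ {A : Type u} [CommRing A] [IsLocalRing A]
    [IsNoetherianRing A] {x : A} [IsLocalRing (A ⧸ Ideal.span {x})] :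
    (maximalIdeal A).spanFinrank ≤ (maximalIdeal (A ⧸ Ideal.span {x})).spanFinrank + 1 := by
  let π := Ideal.Quotient.mk (Ideal.span {x})
  have hloc : IsLocalHom π := IsLocalHom.of_surjective _ Ideal.Quotient.mk_surjective
  have hfg : (maximalIdeal (A ⧸ Ideal.span {x})).FG := IsNoetherian.noetherian _
  have hfin := Submodule.FG.finite_generators hfg
  choose g hg using (Ideal.Quotient.mk_surjective : Function.Surjective π)
  have hgen : maximalIdeal (A ⧸ Ideal.span {x}) =
      (Ideal.span (g '' (maximalIdeal (A ⧸ Ideal.span {x})).generators)).map π := by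
    rw [Ideal.map_span, ← Set.image_comp, show π ∘ g = id from funext hg, Set.image_id]
    exact (Submodule.span_generators _).symm
  have hm : maximalIdeal A =
      Ideal.span (g '' (maximalIdeal (A ⧸ Ideal.span {x})).generators ∪ {x}) := by
    have h1 : (maximalIdeal (A ⧸ Ideal.span {x})).comap π = maximalIdeal A :=
      ((local_hom_TFAE π).out 0 4).mp hloc
    rw [← h1, hgen, Ideal.comap_map_of_surjective' _ Ideal.Quotient.mk_surjective, Ideal.mk_ker,
      Ideal.span_union, ← hgen]
  rw [hm]
  refine (Submodule.spanFinrank_span_le_ncard_of_finite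
    ((hfin.image _).union (Set.finite_singleton x))).trans ?_
  refine (Set.ncard_union_le _ _).trans ?_
  rw [Set.ncard_singleton, ← Submodule.FG.generators_ncard hfg]
  exact Nat.add_le_add_right (Set.ncard_image_le hfin) 1

/-- If the maximal ideal is nonzero and associated, it would be free and yet killed by a nonzero
socle element. Otherwise prime avoidance finds a regular element outside its square; the hypothesis
passes to the quotient by it, and regularity lifts back. -/
theorem IsRegularLocalRing.of_hasProjDimLE_maximalIdeal (A : Type u) [CommRing A] [IsLocalRing A]
    [IsNoetherianRing A] {n : ℕ} (h : HasProjDimLE A (maximalIdeal A) n) :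
    IsRegularLocalRing A := by
  generalize hd : (maximalIdeal A).spanFinrank = d
  induction d using Nat.strong_induction_on generalizing A with
  | _ d ih =>
  by_cases hbot : maximalIdeal A = ⊥
  · apply IsRegularLocalRing.of_spanFinrank_maximalIdeal_le
    rw [hbot, Submodule.spanFinrank_bot]
    exact ringKrullDim_nonneg_of_nontrivial
  by_cases hass : maximalIdeal A ∈ associatedPrimes A A
  · exfalso
    obtain ⟨-, s, hs⟩ := (isAssociatedPrime_iff (M := A)).mp hass
    have hsm : ∀ a ∈ maximalIdeal A, s * a = 0 := by
      intro a ha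
      rw [hs] at ha
      rw [mul_comm]
      simpa [Submodule.mem_colon_singleton] using ha
    have hs0 : s ≠ 0 := by
      rintro rfl
      refine (maximalIdeal.isMaximal A).ne_top (hs.trans ?_)
      simp
    have hfree := h.free_of_socle hs0 hsm
    have : Nontrivial (maximalIdeal A) := Submodule.nontrivial_iff_ne_bot.mpr hbot
    let b := Module.Free.chooseBasis A (maximalIdeal A)
    obtain ⟨i⟩ : Nonempty (Module.Free.ChooseBasisIndex A (maximalIdeal A)) := b.index_nonempty
    have h1 : s • b i = 0 := Subtype.ext (hsm _ (b i).2)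
    have h2 := congrArg (fun v => b.repr v i) h1
    simp at h2
    exact hs0 h2
  · obtain ⟨x, hx, hx2, hxp⟩ := exists_mem_maximalIdeal_notMem_sq hbot (associatedPrimes A A)
      (associatedPrimes.finite A A) (fun p hp => hp.isPrime) (fun p hp h => hass (h ▸ hp))
    have hreg : IsSMulRegular A x := by
      by_contra hnr
      have : x ∈ ⋃ p ∈ associatedPrimes A A, (p : Set A) := by
        rw [biUnion_associatedPrimes_eq_compl_regular]
        exact hnr
      simp only [Set.mem_iUnion] at this
      obtain ⟨p, hp, hxp'⟩ := this
      exact hxp p hp hxp'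
    have := isLocalRing_quotient_span_singleton hx
    have h1 := spanFinrank_maximalIdeal_quotient_succ_le hx hx2
    have hB := ih _ (by omega) (A ⧸ Ideal.span {x}) (h.maximalIdeal_quotient hx hx2 hreg) rfl
    apply IsRegularLocalRing.of_spanFinrank_maximalIdeal_le
    rw [← ringKrullDim_quotient_span_singleton_succ_eq_ringKrullDim hreg hx,
      ← (isRegularLocalRing_iff (A ⧸ Ideal.span {x})).mp inferInstance]
    have h4 : (maximalIdeal A).spanFinrank ≤ (maximalIdeal (A ⧸ Ideal.span {x})).spanFinrank + 1 :=
      spanFinrank_maximalIdeal_le_quotient_succ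
    exact_mod_cast h4

/-- The prime `p` has finite projective dimension over `A`. Localization preserves this and turns
`p` into the maximal ideal of `A_p`, so the homological criterion applies. -/
theorem IsRegularLocalRing.localization (A : Type u) [CommRing A] [IsRegularLocalRing A]
    (p : Ideal A) [p.IsPrime] : IsRegularLocalRing (Localization.AtPrime p) := by
  obtain ⟨n, hn⟩ := IsRegularLocalRing.exists_hasProjDimLE A p
  have h0 : HasProjectiveDimensionLE (ModuleCat.of A p) n := hn
  have h1 := (ModuleCat.of A p).localizedModule_hasProjectiveDimensionLE n p.primeCompl
  apply IsRegularLocalRing.of_hasProjDimLE_maximalIdeal (Localization.AtPrime p) (n := n)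
  have e : (ModuleCat.of A p).localizedModule p.primeCompl ≃ₗ[Localization.AtPrime p]
      p.map (algebraMap A (Localization.AtPrime p)) :=
    (Shrink.linearEquiv (Localization.AtPrime p) (LocalizedModule p.primeCompl p)).trans <|
      LinearEquiv.extendScalarsOfIsLocalization p.primeCompl (Localization.AtPrime p)
        (IsLocalizedModule.linearEquiv p.primeCompl (LocalizedModule.mkLinearMap p.primeCompl p)
          (Algebra.idealMap (Localization.AtPrime p) p))
  rw [Localization.AtPrime.map_eq_maximalIdeal] at e
  exact HasProjDimLE.of_linearEquiv (A := Localization.AtPrime p)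
    (M := (ModuleCat.of A p).localizedModule p.primeCompl) h1 e

end

/-! ### Depth: passage to quotients, localization and flat descent. -/

section

open IsLocalRing CategoryTheory Module RingTheory.Sequence Pointwise TensorProduct

/-- There is an `M`-regular sequence of length `n` in the maximal ideal of `A`. -/
def HasRegularSeq (A : Type u) [CommRing A] [IsLocalRing A] (M : Type u) [AddCommGroup M]
    [Module A M] (n : ℕ) : Prop :=
  ∃ rs : List A, rs.length = n ∧ (∀ r ∈ rs, r ∈ maximalIdeal A) ∧ IsRegular M rs

section Ass

variable {A : Type u} [CommRing A] [IsNoetherianRing A] {M : Type u} [AddCommGroup M] [Module A M]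

theorem exists_of_mem_associatedPrimes {q : Ideal A}
    (hq : q ∈ associatedPrimes A M) : ∃ w : M, w ≠ 0 ∧ ∀ a, a ∈ q ↔ a • w = 0 := by
  obtain ⟨hp, w, hw⟩ := isAssociatedPrime_iff.mp hq
  have h : ∀ a, a ∈ q ↔ a • w = 0 := fun a => by
    rw [hw, Submodule.mem_colon_singleton, Submodule.mem_bot]
  refine ⟨w, ?_, h⟩
  rintro rfl
  exact hp.ne_top ((Ideal.eq_top_iff_one q).mpr ((h 1).mpr (smul_zero _)))

theorem exists_le_associatedPrime [Module.Finite A M] {p : Ideal A}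
    (h : ∀ x ∈ p, ¬ IsSMulRegular M x) : ∃ q ∈ associatedPrimes A M, p ≤ q := by
  refine (Ideal.subset_union_prime_finite (associatedPrimes.finite A M)
    (f := fun q => q) ⊤ ⊤ fun q hq _ _ => hq.isPrime).mp ?_
  rw [biUnion_associatedPrimes_eq_compl_regular]
  exact fun x hx => h x hx

end Ass

section Depth

variable {A : Type u} [CommRing A] [IsLocalRing A]

theorem HasRegularSeq.nontrivial {M : Type u} [AddCommGroup M] [Module A M] {n : ℕ}
    (h : HasRegularSeq A M n) : Nontrivial M := by
  obtain ⟨rs, -, -, h⟩ := h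
  exact h.nontrivial

theorem HasRegularSeq.of_linearEquiv {M N : Type u} [AddCommGroup M] [Module A M]
    [AddCommGroup N] [Module A N] {n : ℕ} (h : HasRegularSeq A M n) (e : M ≃ₗ[A] N) :
    HasRegularSeq A N n := by
  obtain ⟨rs, h1, h2, h3⟩ := h
  exact ⟨rs, h1, h2, (e.isRegular_congr rs).mp h3⟩

theorem HasRegularSeq.zero {M : Type u} [AddCommGroup M] [Module A M] [Nontrivial M] :
    HasRegularSeq A M 0 :=
  ⟨[], rfl, by simp, .nil _ _⟩

theorem HasRegularSeq.cons {M : Type u} [AddCommGroup M] [Module A M] {n : ℕ} {x : A}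
    (hx : x ∈ maximalIdeal A) (hreg : IsSMulRegular M x)
    (h : HasRegularSeq A (QuotSMulTop x M) n) : HasRegularSeq A M (n + 1) := by
  obtain ⟨rs, h1, h2, h3⟩ := h
  exact ⟨x :: rs, by simp [h1], List.forall_mem_cons.mpr ⟨hx, h2⟩, .cons hreg h3⟩

theorem HasRegularSeq.exists_regular {M : Type u} [AddCommGroup M] [Module A M] {n : ℕ}
    (h : HasRegularSeq A M (n + 1)) : ∃ x ∈ maximalIdeal A, IsSMulRegular M x ∧
      HasRegularSeq A (QuotSMulTop x M) n := by
  obtain ⟨rs, h1, h2, h3⟩ := h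
  obtain _ | ⟨x, rs⟩ := rs
  · simp at h1
  · rw [isRegular_cons_iff] at h3
    exact ⟨x, h2 x (by simp), h3.1, rs, by simpa using h1, fun r hr => h2 r (by simp [hr]), h3.2⟩

theorem HasRegularSeq.mono {M : Type u} [AddCommGroup M] [Module A M] [Module.Finite A M]
    {m n : ℕ} (h : HasRegularSeq A M n) (hmn : m ≤ n) : HasRegularSeq A M m := by
  have := h.nontrivial
  obtain ⟨rs, h1, h2, h3⟩ := h
  have h4 : ∀ r ∈ rs.take m, r ∈ maximalIdeal A := fun r hr => h2 r (List.mem_of_mem_take hr)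
  refine ⟨rs.take m, by simp [h1, hmn], h4, ?_⟩
  rw [isRegular_iff_isWeaklyRegular_of_subset_maximalIdeal h4]
  have h5 := h3.toIsWeaklyRegular
  rw [← List.take_append_drop m rs, isWeaklyRegular_append_iff] at h5
  exact h5.1

variable [IsNoetherianRing A]

/-- Dividing out a regular element lowers the depth by at most one. -/
theorem HasRegularSeq.quotSMulTop {M : Type u} [AddCommGroup M] [Module A M] [Module.Finite A M]
    {n : ℕ} (h : HasRegularSeq A M (n + 1)) {x : A} (hx : x ∈ maximalIdeal A)
    (hreg : IsSMulRegular M x) : HasRegularSeq A (QuotSMulTop x M) n := by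
  have := h.nontrivial
  have hlt : ∀ (N : Type u) [AddCommGroup N] [Module A N] [Module.Finite A N] [Nontrivial N],
      maximalIdeal A • (⊤ : Submodule A N) < ⊤ := by
    intro N _ _ _ _
    exact (Submodule.top_ne_ideal_smul_of_le_jacobson_annihilator
      (maximalIdeal_le_jacobson _)).symm.lt_top
  have : Nontrivial (QuotSMulTop x M) := nontrivial_quotSMulTop_of_mem_maximalIdeal M hx
  -- Depth is read off from vanishing of Ext out of a test module `N`; the long exact sequence of
  -- multiplication by `x` shortens the vanishing range by one.
  have h1 := (ModuleCat.exists_isRegular_tfae (maximalIdeal A) (n + 1) (ModuleCat.of A M)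
    (hlt M)).out 3 2
  have h2 := (ModuleCat.exists_isRegular_tfae (maximalIdeal A) n
    (ModuleCat.of A (QuotSMulTop x M)) (hlt _)).out 2 3
  obtain ⟨N, hN1, hN2, hN3, hN4⟩ := h1.mp h
  refine h2.mp ⟨N, hN1, hN2, hN3, fun i hi => ?_⟩
  have zero1 := AddCommGrpCat.isZero_of_iff_subsingleton.mpr (hN4 i (by omega))
  have zero2 := AddCommGrpCat.isZero_of_iff_subsingleton.mpr (hN4 (i + 1) (by omega))
  exact AddCommGrpCat.subsingleton_of_isZero <| ShortComplex.Exact.isZero_of_both_zeros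
    ((Abelian.Ext.covariant_sequence_exact₃' N
      (IsSMulRegular.smulShortComplex_shortExact (M := ModuleCat.of A M) hreg)) i (i + 1) rfl)
    (zero1.eq_zero_of_src _) (zero2.eq_zero_of_tgt _)

/-- If an associated prime of `M` has coheight one, then `M` has depth at most one. -/
theorem not_hasRegularSeq_two_of_mem_associatedPrimes {M : Type u} [AddCommGroup M] [Module A M]
    [Module.Finite A M] {q : Ideal A} (hq : q ∈ associatedPrimes A M)
    (hcov : ∀ r : Ideal A, r.IsPrime → q < r → r = maximalIdeal A) : ¬ HasRegularSeq A M 2 := by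
  intro h
  obtain ⟨y, hy, hyreg, h⟩ := h.exists_regular
  obtain ⟨z, hz, hzreg, -⟩ := h.exists_regular
  obtain ⟨w₀, hw₀, hqw⟩ := exists_of_mem_associatedPrimes hq
  have hyq : y ∉ q := fun hyq => hw₀ (hyreg.right_eq_zero_of_smul ((hqw y).mp hyq))
  -- `U` is the part of `M` killed by `q`. It is nonzero, so Nakayama gives `w` in `U` outside `y
  -- U`. A power of `z` lies in `q + (y)`, hence kills `w` modulo `y M`; as `z` is regular there, `w
  -- = y v`, and regularity of `y` forces `v ∈ U`, a contradiction.
  let U : Submodule A M := Submodule.torsionBySet A M q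
  have hU : ∀ v, v ∈ U ↔ ∀ a ∈ q, a • v = 0 := fun v => by
    simp [U, Submodule.mem_torsionBySet_iff]
  obtain ⟨w, hwU, hw⟩ : ∃ w ∈ U, w ∉ y • U := by
    by_contra! hcon
    have h0 : U = ⊥ := by
      refine Submodule.eq_bot_of_le_smul_of_le_jacobson_bot (maximalIdeal A) _
        (IsNoetherian.noetherian _) (fun w hw => ?_) (maximalIdeal_le_jacobson _)
      obtain ⟨v, hv, rfl⟩ := hcon w hw
      exact Submodule.smul_mem_smul hy hv
    exact hw₀ ((Submodule.eq_bot_iff _).mp h0 w₀ ((hU w₀).mpr fun a ha => (hqw a).mp ha))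
  have hrad : z ∈ (q ⊔ Ideal.span {y}).radical := by
    rw [Ideal.radical_eq_sInf, Ideal.mem_sInf]
    rintro r ⟨hr, hrp⟩
    have hyr : y ∈ r := hr (Ideal.mem_sup_right (Ideal.mem_span_singleton_self y))
    have hqr : q < r := lt_of_le_of_ne (le_sup_left.trans hr) fun e => hyq (e ▸ hyr)
    rwa [hcov r hrp hqr]
  obtain ⟨k, hk⟩ := hrad
  obtain ⟨a, ha, b, hb, hab⟩ := Submodule.mem_sup.mp hk
  obtain ⟨c, rfl⟩ := Ideal.mem_span_singleton'.mp hb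
  have h1 : z ^ k • (Submodule.Quotient.mk w : QuotSMulTop y M) = 0 := by
    rw [← Submodule.Quotient.mk_smul, ← hab, add_smul, (hU w).mp hwU a ha, zero_add,
      Submodule.Quotient.mk_eq_zero, mul_comm, mul_smul]
    exact Submodule.smul_mem_pointwise_smul _ _ _ trivial
  have h2 := (hzreg.pow k).right_eq_zero_of_smul h1
  obtain ⟨v, -, hv⟩ := (Submodule.Quotient.mk_eq_zero _).mp h2
  refine hw ⟨v, (hU v).mpr fun a ha => hyreg.right_eq_zero_of_smul ?_, hv⟩
  have hv' : y • v = w := hv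
  rw [smul_comm, hv', (hU w).mp hwU a ha]

theorem HasRegularSeq.exists_isRegular_mem_of_covBy {p : Ideal A} [p.IsPrime]
    (hcov : ∀ r : Ideal A, r.IsPrime → p < r → r = maximalIdeal A) {n : ℕ} {M : Type u}
    [AddCommGroup M] [Module A M] [Module.Finite A M] (h : HasRegularSeq A M (n + 1)) :
    ∃ rs : List A, rs.length = n ∧ (∀ r ∈ rs, r ∈ p) ∧ IsRegular M rs := by
  induction n generalizing M with
  | zero =>
    have := h.nontrivial
    exact ⟨[], rfl, by simp, .nil _ _⟩
  | succ n ih =>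
    -- Without such an `x`, the prime `p` lies in an associated prime with nothing but the maximal
    -- ideal above it, which is incompatible with depth at least two.
    obtain ⟨x, hxp, hxreg⟩ : ∃ x ∈ p, IsSMulRegular M x := by
      by_contra! hcon
      obtain ⟨q, hq, hpq⟩ := exists_le_associatedPrime hcon
      have hqp := hq.isPrime
      have hcovq : ∀ r : Ideal A, r.IsPrime → q < r → r = maximalIdeal A :=
        fun r hr hqr => hcov r hr (hpq.trans_lt hqr)
      exact not_hasRegularSeq_two_of_mem_associatedPrimes hq hcovq (h.mono (by omega))
    have hxm : x ∈ maximalIdeal A := le_maximalIdeal_of_isPrime p hxp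
    obtain ⟨rs, h1, h2, h3⟩ := ih (h.quotSMulTop hxm hxreg)
    exact ⟨x :: rs, by simp [h1], List.forall_mem_cons.mpr ⟨hxp, h2⟩, .cons hxreg h3⟩

theorem HasRegularSeq.localization_of_covBy {p : Ideal A} [p.IsPrime]
    (hcov : ∀ r : Ideal A, r.IsPrime → p < r → r = maximalIdeal A) {n : ℕ}
    (h : HasRegularSeq A A (n + 1)) (B : Type u) [CommRing B] [Algebra A B] [IsLocalRing B]
    [IsLocalization.AtPrime B p] : HasRegularSeq B B n := by
  obtain ⟨rs, h1, h2, h3⟩ := h.exists_isRegular_mem_of_covBy hcov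
  refine ⟨rs.map (algebraMap A B), by simp [h1], ?_,
    h3.toIsWeaklyRegular.isRegular_of_isLocalization_of_mem B p h2⟩
  intro r hr
  obtain ⟨s, hs, rfl⟩ := List.mem_map.mp hr
  exact (IsLocalization.AtPrime.to_map_mem_maximal_iff B p s).mpr (h2 s hs)

end Depth

/-- Descent of depth along a flat local homomorphism with zero-dimensional reduced fibre. -/
theorem HasRegularSeq.of_flat {A C : Type u} [CommRing A] [IsLocalRing A] [IsNoetherianRing A]
    [CommRing C] [IsLocalRing C] [IsNoetherianRing C] [Algebra A C] [Module.Flat A C]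
    [IsLocalHom (algebraMap A C)]
    (hmap : (maximalIdeal A).map (algebraMap A C) = maximalIdeal C) {n : ℕ} (M : Type u)
    [AddCommGroup M] [Module A M] [Module.Finite A M] (h : HasRegularSeq C (C ⊗[A] M) n) :
    HasRegularSeq A M n := by
  have hff : Module.FaithfullyFlat A C := Module.FaithfullyFlat.of_flat_of_isLocalHom
  induction n generalizing M with
  | zero =>
    have := h.nontrivial
    have : Nontrivial M := by
      by_contra hM
      rw [not_nontrivial_iff_subsingleton] at hM
      exact not_subsingleton (C ⊗[A] M) inferInstance
    exact .zero
  | succ n ih =>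
    by_cases hex : ∃ x ∈ maximalIdeal A, IsSMulRegular M x
    · obtain ⟨x, hx, hreg⟩ := hex
      have hreg' : IsSMulRegular (C ⊗[A] M) (algebraMap A C x) :=
        hreg.of_flat_of_isBaseChange (TensorProduct.isBaseChange A M C)
      have hx' : algebraMap A C x ∈ maximalIdeal C := hmap ▸ Ideal.mem_map_of_mem _ hx
      exact .cons hx hreg (ih _ ((h.quotSMulTop hx' hreg').of_linearEquiv
        (QuotSMulTop.algebraMapTensorEquivTensorQuotSMulTop x M C)))
    -- Here some nonzero `w` is killed by the maximal ideal of `A`. By faithful flatness `1 ⊗ w` is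
    -- nonzero, and the maximal ideal of `C` is generated from `A`, so it kills `1 ⊗ w`; no regular
    -- `y` can exist.
    · push Not at hex
      exfalso
      obtain ⟨q, hq, hmq⟩ := exists_le_associatedPrime hex
      obtain ⟨w, hw, hqw⟩ := exists_of_mem_associatedPrimes hq
      obtain ⟨y, hy, hyreg, -⟩ := h.exists_regular
      have h1 : (1 : C) ⊗ₜ[A] w ≠ 0 := fun h0 =>
        hw (Module.FaithfullyFlat.tensorProduct_mk_injective (A := A) (B := C) M
          (h0.trans (TensorProduct.tmul_zero _ _).symm))
      have h2 : maximalIdeal C ≤ Ideal.span {a : C | a • ((1 : C) ⊗ₜ[A] w) = 0} := by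
        rw [← hmap, Ideal.map_le_iff_le_comap]
        intro a ha
        refine Ideal.subset_span ?_
        change algebraMap A C a • ((1 : C) ⊗ₜ[A] w) = 0
        rw [algebraMap_smul, ← TensorProduct.tmul_smul, (hqw a).mp (hmq ha),
          TensorProduct.tmul_zero]
      have h3 : ∀ c ∈ Ideal.span {a : C | a • ((1 : C) ⊗ₜ[A] w) = 0},
          c • ((1 : C) ⊗ₜ[A] w) = 0 := by
        intro c hc
        refine Submodule.span_induction (fun _ h => h) (zero_smul _ _)
          (fun a b _ _ ha hb => by rw [add_smul, ha, hb, add_zero])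
          (fun a b _ hb => by rw [smul_assoc, hb, smul_zero]) hc
      exact h1 (hyreg.right_eq_zero_of_smul (h3 y (h2 hy)))

end

/-! ### The local Serre condition and polynomial extensions of a local ring. -/

section

open IsLocalRing Module RingTheory.Sequence Pointwise Polynomial

/-- The condition `depth A ≥ min {i, dim A}` on a local ring `A`, in terms of the existence of
regular sequences. -/
def SerreLocal (i : ℕ) (A : Type u) [CommRing A] [IsLocalRing A] : Prop :=
  ∀ n : ℕ, n ≤ i → (n : WithBot ℕ∞) ≤ ringKrullDim A → HasRegularSeq A A n

theorem natCast_le_localDepth_iff {A : Type u} [CommRing A] [IsLocalRing A] {n : ℕ} :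
    (n : ℕ∞) ≤ localDepth A ↔ HasRegularSeq A A n := by
  constructor
  · intro h
    obtain _ | n := n
    · exact .zero
    -- The supremum is not known to be attained; the strict inequality yields a sequence of length
    -- at least `n + 1`, which is then truncated.
    · have h1 : (n : ℕ∞) < localDepth A := lt_of_lt_of_le (by exact_mod_cast Nat.lt_succ_self n) h
      rw [localDepth, lt_iSup_iff] at h1
      obtain ⟨rs, h1⟩ := h1
      rw [lt_iSup_iff] at h1
      obtain ⟨⟨h2, h3⟩, h1⟩ := h1
      exact HasRegularSeq.mono ⟨rs, rfl, h2, h3⟩ (by exact_mod_cast h1)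
  · rintro ⟨rs, rfl, h2, h3⟩
    exact le_iSup₂_of_le rs ⟨h2, h3⟩ le_rfl

theorem serreLocal_iff {A : Type u} [CommRing A] [IsLocalRing A] [IsNoetherianRing A] {i : ℕ} :
    SerreLocal i A ↔
      min (i : WithBot ℕ∞) (ringKrullDim A) ≤ (localDepth A : WithBot ℕ∞) := by
  constructor
  · intro h
    obtain ⟨d, hd⟩ : ∃ d : ℕ, ringKrullDim A = d := by
      obtain ⟨d, hd⟩ := ENat.ne_top_iff_exists.mp (Ideal.height_ne_top
        (I := maximalIdeal A) (maximalIdeal.isMaximal A).ne_top)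
      exact ⟨d, by rw [← maximalIdeal_height_eq_ringKrullDim, ← hd]; rfl⟩
    have h1 := h (min i d) (min_le_left _ _) (by rw [hd]; exact_mod_cast min_le_right i d)
    rw [← natCast_le_localDepth_iff] at h1
    rw [hd]
    have h2 : ((min i d : ℕ) : WithBot ℕ∞) ≤ localDepth A := WithBot.coe_le_coe.mpr h1
    refine le_trans (le_of_eq ?_) h2
    rcases le_total i d with hid | hid
    · rw [min_eq_left hid, min_eq_left (by exact_mod_cast hid)]
    · rw [min_eq_right hid, min_eq_right (by exact_mod_cast hid)]
  · intro h n hn hd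
    rw [← natCast_le_localDepth_iff]
    exact WithBot.coe_le_coe.mp ((le_min (by exact_mod_cast hn) hd).trans h)

theorem satisfiesS_iff {A : Type u} [CommRing A] [IsNoetherianRing A] {i : ℕ} :
    SatisfiesS i A ↔ ∀ (p : Ideal A) [p.IsPrime], SerreLocal i (Localization.AtPrime p) :=
  ⟨fun h p _ => serreLocal_iff.mpr (h p), fun h p _ => serreLocal_iff.mp (h p)⟩

theorem SerreLocal.mono {A : Type u} [CommRing A] [IsLocalRing A] {i j : ℕ} (h : SerreLocal j A)
    (hij : i ≤ j) : SerreLocal i A :=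
  fun n hn hd => h n (hn.trans hij) hd

theorem SerreLocal.of_ringEquiv {A B : Type u} [CommRing A] [IsLocalRing A] [CommRing B]
    [IsLocalRing B] {i : ℕ} (h : SerreLocal i A) (e : A ≃+* B) : SerreLocal i B := by
  intro n hn hd
  rw [← ringKrullDim_eq_of_ringEquiv e] at hd
  obtain ⟨rs, h1, h2, h3⟩ := h n hn hd
  refine ⟨rs.map e, by simp [h1], ?_, ?_⟩
  · intro r hr
    obtain ⟨s, hs, rfl⟩ := List.mem_map.mp hr
    have : IsLocalHom (e : A →+* B) := inferInstance
    exact map_mem_nonunits_iff (e : A →+* B) s |>.mpr (h2 s hs)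
  · refine (e.toAddEquiv.isRegular_congr ?_).mp h3
    exact List.forall₂_map_right_iff.mpr (List.forall₂_same.mpr fun r _ x => e.map_mul r x)

section Quotient

variable {A G : Type u} [CommRing A] [IsLocalRing A] [IsNoetherianRing A] [CommRing G]
  [IsLocalRing G] (f : A →+* G) (hf : Function.Surjective f) {u : A}
  (hker : RingHom.ker f = Ideal.span {u}) (hu : u ∈ maximalIdeal A) (hreg : IsSMulRegular A u)

include hf hker hu hreg

omit [IsNoetherianRing A] in
theorem HasRegularSeq.of_surjective {n : ℕ} (h : HasRegularSeq G G n) :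
    HasRegularSeq A A (n + 1) := by
  obtain ⟨rs, h1, h2, h3⟩ := h
  choose g hg using hf
  have hloc : IsLocalHom f := IsLocalHom.of_surjective _ fun y => ⟨g y, hg y⟩
  have hker' : u • (⊤ : Submodule A A) = RingHom.ker f := by
    rw [← Submodule.ideal_span_singleton_smul, smul_eq_mul, Ideal.mul_top, hker]
  let e : QuotSMulTop u A ≃+ G :=
    (Submodule.quotEquivOfEq _ _ hker').toAddEquiv.trans
      (RingHom.quotientKerEquivOfSurjective (f := f) fun y => ⟨g y, hg y⟩).toAddEquiv
  have he : ∀ (r : A) (x : QuotSMulTop u A), e (r • x) = f r * e x := by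
    intro r x
    obtain ⟨x, rfl⟩ := Submodule.Quotient.mk_surjective _ x
    exact map_mul f r x
  refine HasRegularSeq.cons hu hreg ⟨rs.map g, by simp [h1], ?_, ?_⟩
  · intro r hr
    obtain ⟨s, hs, rfl⟩ := List.mem_map.mp hr
    refine (map_mem_nonunits_iff f _).mp ?_
    rw [hg]
    exact h2 s hs
  · refine (e.isRegular_congr ?_).mpr h3
    refine List.forall₂_map_left_iff.mpr (List.forall₂_same.mpr fun r _ x => ?_)
    rw [he, hg, smul_eq_mul]

omit [IsLocalRing G] in
theorem ringKrullDim_add_one_of_surjective : ringKrullDim G + 1 = ringKrullDim A := by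
  rw [← ringKrullDim_quotient_span_singleton_succ_eq_ringKrullDim hreg hu,
    ringKrullDim_eq_of_ringEquiv ((Ideal.quotEquivOfEq hker.symm).trans
      (RingHom.quotientKerEquivOfSurjective hf))]

/-- Prepending `u` raises depth by one, and dimension rises by exactly one. The gain in the index is
what later pays for localizing. -/
theorem SerreLocal.of_surjective {i : ℕ} (h : SerreLocal i G) : SerreLocal (i + 1) A := by
  intro n hn hd
  obtain _ | n := n
  · exact .zero
  · refine HasRegularSeq.of_surjective f hf hker hu hreg (h n (by omega) ?_)
    rw [← ringKrullDim_add_one_of_surjective f hf hker hu hreg] at hd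
    push_cast at hd
    exact ENat.WithBot.add_le_add_one_right_iff.mp hd

omit [IsLocalRing G] in
-- The embedding dimension grows by at most one, while the dimension grows by one because `u` is
-- regular.
theorem IsRegularLocalRing.of_surjective [IsRegularLocalRing G] : IsRegularLocalRing A := by
  have e := (Ideal.quotEquivOfEq hker.symm).trans (RingHom.quotientKerEquivOfSurjective hf)
  have : IsRegularLocalRing (A ⧸ Ideal.span {u}) := IsRegularLocalRing.of_ringEquiv e.symm
  apply IsRegularLocalRing.of_spanFinrank_maximalIdeal_le
  rw [← ringKrullDim_quotient_span_singleton_succ_eq_ringKrullDim hreg hu,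
    ← (isRegularLocalRing_iff (A ⧸ Ideal.span {u})).mp inferInstance]
  exact_mod_cast spanFinrank_maximalIdeal_le_quotient_succ (x := u)

end Quotient

/-- The dimension of `A` exceeds the height of `p` by at least one, so `A` has a regular sequence
one longer than needed; a sequence of the required length can be found inside `p`. -/
theorem SerreLocal.localization_of_covBy {A : Type u} [CommRing A] [IsLocalRing A]
    [IsNoetherianRing A] {p : Ideal A} [p.IsPrime] (hp : p < maximalIdeal A)
    (hcov : ∀ r : Ideal A, r.IsPrime → p < r → r = maximalIdeal A) {i : ℕ}
    (h : SerreLocal (i + 1) A) (B : Type u) [CommRing B] [Algebra A B] [IsLocalRing B]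
    [IsLocalization.AtPrime B p] : SerreLocal i B := by
  intro n hn hd
  refine HasRegularSeq.localization_of_covBy hcov (h (n + 1) (by omega) ?_) B
  rw [IsLocalization.AtPrime.ringKrullDim_eq_height p] at hd
  rw [← maximalIdeal_height_eq_ringKrullDim]
  have h1 : (n : ℕ∞) ≤ p.height := by exact_mod_cast hd
  have h2 : ((n + 1 : ℕ) : ℕ∞) ≤ (maximalIdeal A).height := by
    push_cast
    exact (add_le_add_left h1 1).trans (Ideal.height_add_one_le_of_lt_of_isPrime hp)
  exact_mod_cast h2

section Polynomial

variable {A : Type u} [CommRing A] [IsLocalRing A] [IsNoetherianRing A]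

omit [IsNoetherianRing A] in
theorem flat_localization_polynomial (P : Ideal A[X]) [P.IsPrime] :
    Module.Flat A (Localization.AtPrime P) :=
  Module.Flat.trans A A[X] (Localization.AtPrime P)

omit [IsNoetherianRing A] in
theorem map_maximalIdeal_localization_map_C (P : Ideal A[X]) [P.IsPrime]
    (hP : P = (maximalIdeal A).map C) :
    (maximalIdeal A).map (algebraMap A (Localization.AtPrime P)) =
      maximalIdeal (Localization.AtPrime P) := by
  rw [IsScalarTower.algebraMap_eq A A[X] (Localization.AtPrime P), ← Ideal.map_map,
    Polynomial.algebraMap_eq, ← hP, Localization.AtPrime.map_eq_maximalIdeal]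

theorem isLocalHom_of_map_maximalIdeal_eq {A B : Type u} [CommRing A] [IsLocalRing A] [CommRing B]
    [IsLocalRing B] {f : A →+* B} (h : (maximalIdeal A).map f = maximalIdeal B) :
    IsLocalHom f :=
  ((local_hom_TFAE f).out 0 2).mpr h.le

theorem ringKrullDim_localization_map_C (P : Ideal A[X]) [P.IsPrime]
    (hP : P = (maximalIdeal A).map C) :
    ringKrullDim (Localization.AtPrime P) = ringKrullDim A := by
  rw [IsLocalization.AtPrime.ringKrullDim_eq_height P, hP, Polynomial.height_map_C,
    maximalIdeal_height_eq_ringKrullDim]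

theorem SerreLocal.of_localization_map_C (P : Ideal A[X]) [P.IsPrime]
    (hP : P = (maximalIdeal A).map C) {i : ℕ} (h : SerreLocal i (Localization.AtPrime P)) :
    SerreLocal i A := by
  intro n hn hd
  have := flat_localization_polynomial P
  have hmap := map_maximalIdeal_localization_map_C P hP
  have := isLocalHom_of_map_maximalIdeal_eq hmap
  rw [← ringKrullDim_localization_map_C P hP] at hd
  exact HasRegularSeq.of_flat hmap A
    ((h n hn hd).of_linearEquiv (TensorProduct.AlgebraTensorModule.rid A _ _).symm)

omit [IsNoetherianRing A] in
-- Modulo `rs` the ring is again a polynomial ring, where a monic polynomial is a nonzerodivisor.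
theorem isWeaklyRegular_append_monic {rs : List A} (h : IsWeaklyRegular A rs) {y : A[X]}
    (hy : y.Monic) : IsWeaklyRegular A[X] (rs.map (algebraMap A A[X]) ++ [y]) := by
  rw [isWeaklyRegular_append_iff, isWeaklyRegular_singleton_iff]
  refine ⟨h.of_flat, ?_⟩
  have hJ : (Ideal.ofList (rs.map (algebraMap A A[X])) • ⊤ : Submodule A[X] A[X]) =
      RingHom.ker (mapRingHom (Ideal.Quotient.mk (Ideal.ofList rs))) := by
    rw [Polynomial.ker_mapRingHom, Ideal.mk_ker, smul_eq_mul, Ideal.mul_top, ← Ideal.map_ofList,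
      Polynomial.algebraMap_eq]
  rw [hJ, isSMulRegular_iff_right_eq_zero_of_smul]
  intro g hg
  obtain ⟨g, rfl⟩ := Submodule.Quotient.mk_surjective _ g
  rw [← Submodule.Quotient.mk_smul, Submodule.Quotient.mk_eq_zero, RingHom.mem_ker, smul_eq_mul,
    map_mul] at hg
  rw [Submodule.Quotient.mk_eq_zero, RingHom.mem_ker]
  exact ((hy.map _).mul_right_eq_zero_iff).mp hg

theorem SerreLocal.localization_polynomial {i : ℕ} (h : SerreLocal i A) (P : Ideal A[X])
    [P.IsPrime] (hP : P.comap C = maximalIdeal A) : SerreLocal i (Localization.AtPrime P) := by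
  intro n hn hd
  have hCP : ∀ {rs : List A}, (∀ r ∈ rs, r ∈ maximalIdeal A) →
      ∀ r ∈ rs.map (algebraMap A A[X]), r ∈ P := by
    intro rs hrs r hr
    obtain ⟨s, hs, rfl⟩ := List.mem_map.mp hr
    have := hrs s hs
    rwa [← hP, Ideal.mem_comap] at this
  have key : ∀ rs' : List A[X], rs'.length = n → (∀ r ∈ rs', r ∈ P) → IsWeaklyRegular A[X] rs' →
      HasRegularSeq (Localization.AtPrime P) (Localization.AtPrime P) n := by
    intro rs' h1 h2 h3
    refine ⟨rs'.map (algebraMap _ _), by simp [h1], ?_,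
      h3.isRegular_of_isLocalization_of_mem (Localization.AtPrime P) P h2⟩
    intro r hr
    obtain ⟨s, hs, rfl⟩ := List.mem_map.mp hr
    exact (IsLocalization.AtPrime.to_map_mem_maximal_iff (Localization.AtPrime P) P s).mpr (h2 s hs)
  by_cases hPm : P = (maximalIdeal A).map C
  · rw [ringKrullDim_localization_map_C P hPm] at hd
    obtain ⟨rs, h1, h2, h3⟩ := h n hn hd
    exact key (rs.map (algebraMap A A[X])) (by simp [h1]) (hCP h2) h3.toIsWeaklyRegular.of_flat
  · obtain _ | n := n
    · exact .zero
    -- Away from the generic point of the fibre, `P` contains a monic `y`. The height of `P` exceeds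
    -- the dimension of `A` by at most one, and appending `y` supplies the extra term.
    · have hle : (maximalIdeal A).map C ≤ P := Ideal.map_le_iff_le_comap.mpr hP.ge
      have hmax : (P.comap C).IsMaximal := hP ▸ maximalIdeal.isMaximal A
      obtain ⟨y, hy, hPy⟩ := Polynomial.exists_monic_span_sup_map_eq A P hmax (by rwa [hP])
      have hyP : y ∈ P := by
        rw [hPy]
        exact Ideal.mem_sup_right (Ideal.mem_span_singleton_self y)
      rw [IsLocalization.AtPrime.ringKrullDim_eq_height P] at hd
      have h4 := hd.trans (Ideal.height_le_ringKrullDim_of_ne_top (I := P) Ideal.IsPrime.ne_top')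
      rw [Polynomial.ringKrullDim_of_isNoetherianRing] at h4
      push_cast at h4
      obtain ⟨rs, h1, h2, h3⟩ := h n (by omega) (ENat.WithBot.add_le_add_one_right_iff.mp h4)
      refine key (rs.map (algebraMap A A[X]) ++ [y]) (by simp [h1]) ?_
        (isWeaklyRegular_append_monic h3.toIsWeaklyRegular hy)
      intro r hr
      rcases List.mem_append.mp hr with hr | hr
      · exact hCP h2 r hr
      · rw [List.mem_singleton] at hr
        exact hr ▸ hyP

/-- Images of elements of `maximalIdeal A` span the cotangent space of `B`, so a basis can be chosen
among them. The chosen elements generate `maximalIdeal B`, hence already `maximalIdeal A`, because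
ideals contract back along a faithfully flat map. -/
theorem spanFinrank_maximalIdeal_le_of_faithfullyFlat {A B : Type u} [CommRing A] [IsLocalRing A]
    [IsNoetherianRing A] [CommRing B] [IsLocalRing B] [IsNoetherianRing B] [Algebra A B]
    [Module.FaithfullyFlat A B]
    (hmap : (maximalIdeal A).map (algebraMap A B) = maximalIdeal B) :
    (maximalIdeal A).spanFinrank ≤ (maximalIdeal B).spanFinrank := by
  classical
  have hmem : ∀ a : maximalIdeal A, algebraMap A B a ∈ maximalIdeal B := fun a =>
    hmap ▸ Ideal.mem_map_of_mem _ a.2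
  let h : maximalIdeal A → maximalIdeal B := fun a => ⟨algebraMap A B a, hmem a⟩
  let g : maximalIdeal A → CotangentSpace B := fun a => (maximalIdeal B).toCotangent (h a)
  have hval : ∀ s : Set (maximalIdeal A), Submodule.span B (h '' s) = ⊤ ↔
      (Ideal.span (Subtype.val '' s)).map (algebraMap A B) = maximalIdeal B := by
    intro s
    rw [← (Submodule.map_injective_of_injective (maximalIdeal B).injective_subtype).eq_iff,
      Submodule.map_span, Submodule.map_top, Submodule.range_subtype, ← Set.image_comp,
      Ideal.map_span, ← Set.image_comp]
    rfl
  have hspan : Submodule.span (ResidueField B) (Set.range g) = ⊤ := by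
    have : Set.range g = (maximalIdeal B).toCotangent '' (h '' Set.univ) := by
      rw [← Set.image_comp, Set.image_univ]
      rfl
    rw [this, CotangentSpace.span_image_eq_top_iff, hval, Set.image_univ, Subtype.range_coe,
      Ideal.span_eq, hmap]
  obtain ⟨s, hs1, hs2, hs3⟩ : ∃ s : Set (maximalIdeal A),
      s.ncard = (maximalIdeal B).spanFinrank ∧
      s.Finite ∧ Submodule.span (ResidueField B) (g '' s) = ⊤ := by
    obtain ⟨b, hb1, hb2, hb3⟩ := exists_linearIndependent (ResidueField B) (Set.range g)
    rw [hspan] at hb2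
    have hbfin : b.Finite := hb3.setFinite
    choose! c hc using hb1
    have hcb : g '' (c '' b) = b := by
      rw [← Set.image_comp]
      exact (Set.image_congr fun x hx => hc hx).trans (Set.image_id _)
    have hinj : Set.InjOn c b := fun x hx y hy hxy => by rw [← hc hx, ← hc hy, hxy]
    refine ⟨c '' b, ?_, hbfin.image _, by rw [hcb, hb2]⟩
    rw [hinj.ncard_image, spanFinrank_maximalIdeal_eq_finrank_cotangentSpace]
    have B' := Module.Basis.mk hb3 (by rw [Subtype.range_coe, hb2])
    rw [Module.finrank_eq_nat_card_basis B']
    rfl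
  have hgs : g '' s = (maximalIdeal B).toCotangent '' (h '' s) := by
    rw [← Set.image_comp]
    rfl
  rw [hgs, CotangentSpace.span_image_eq_top_iff, hval] at hs3
  have hm : maximalIdeal A = Ideal.span (Subtype.val '' s) := by
    refine (Ideal.comap_map_eq_self_of_faithfullyFlat (B := B) (maximalIdeal A)).symm.trans ?_
    rw [hmap, ← hs3, Ideal.comap_map_eq_self_of_faithfullyFlat]
  rw [hm, ← hs1]
  exact (Submodule.spanFinrank_span_le_ncard_of_finite (hs2.image _)).trans
    (Set.ncard_image_le hs2)

theorem IsRegularLocalRing.of_localization_map_C (P : Ideal A[X]) [P.IsPrime]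
    (hP : P = (maximalIdeal A).map C) [IsRegularLocalRing (Localization.AtPrime P)] :
    IsRegularLocalRing A := by
  have := flat_localization_polynomial P
  have hmap := map_maximalIdeal_localization_map_C P hP
  have := isLocalHom_of_map_maximalIdeal_eq hmap
  have : Module.FaithfullyFlat A (Localization.AtPrime P) :=
    Module.FaithfullyFlat.of_flat_of_isLocalHom
  apply IsRegularLocalRing.of_spanFinrank_maximalIdeal_le
  rw [← ringKrullDim_localization_map_C P hP,
    ← (isRegularLocalRing_iff (Localization.AtPrime P)).mp inferInstance]
  exact_mod_cast spanFinrank_maximalIdeal_le_of_faithfullyFlat hmap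

end Polynomial

end

/-! ### Localizations of polynomial rings over a general base. -/

section

open IsLocalRing Module Polynomial

theorem comap_C_map_C {R : Type u} [CommRing R] (p : Ideal R) :
    (p.map (C : R →+* R[X])).comap C = p := by
  ext x
  rw [Ideal.mem_comap, Ideal.mem_map_C_iff]
  refine ⟨fun h => by simpa using h 0, fun h n => ?_⟩
  rw [coeff_C]
  split_ifs
  · exact h
  · exact zero_mem _

/-- The localization of `R[X]` at a prime over `p` is a localization of `R_p[X]`. -/
theorem exists_localization_polynomial_equiv {R : Type u} [CommRing R] (P : Ideal R[X]) [P.IsPrime]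
    (p : Ideal R) [p.IsPrime] (hp : P.comap C = p) :
    ∃ (Q : Ideal (Localization.AtPrime p)[X]) (_ : Q.IsPrime),
      Q.comap C = maximalIdeal (Localization.AtPrime p) ∧
      (P = p.map C → Q = (maximalIdeal (Localization.AtPrime p)).map C) ∧
      Nonempty (Localization.AtPrime Q ≃+* Localization.AtPrime P) := by
  subst hp
  let q := P.comap C
  let S := (Localization.AtPrime q)[X]
  let pc := Submonoid.map Polynomial.C.toMonoidHom q.primeCompl
  let : Algebra R[X] S := Polynomial.algebra R (Localization.AtPrime q)
  have : IsLocalization pc S := Polynomial.isLocalization _ _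
  let pS := P.map (algebraMap R[X] S)
  have disj : Disjoint (pc : Set R[X]) (P : Set R[X]) := by
    simpa [pc, q] using! Set.disjoint_image_left.mpr
      (Set.disjoint_compl_left_iff_subset.mpr (fun _ a ↦ a))
  have hpS : pS.IsPrime := IsLocalization.isPrime_of_isPrime_disjoint pc _ _ ‹_› disj
  have : IsLocalization.AtPrime (Localization.AtPrime pS) P := by
    convert IsLocalization.isLocalization_isLocalization_atPrime_isLocalization pc
      (Localization.AtPrime pS) pS
    exact (IsLocalization.under_map_of_isPrime_disjoint pc _ ‹_› disj).symm
  have eq : pS.comap C = maximalIdeal (Localization.AtPrime q) := by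
    rw [← IsLocalization.map_under q.primeCompl _ (pS.comap C),
      ← IsLocalization.map_under q.primeCompl _ (maximalIdeal (Localization.AtPrime q))]
    simp only [Ideal.comap_comap, S, pS]
    rw [← Polynomial.algebraMap_eq (R := Localization.AtPrime q),
      ← IsScalarTower.algebraMap_eq R (Localization.AtPrime q) (Localization.AtPrime q)[X],
      IsScalarTower.algebraMap_eq R R[X] (Localization.AtPrime q)[X], ← Ideal.comap_comap,
      ← Ideal.under_def R[X], IsLocalization.under_map_of_isPrime_disjoint pc _ ‹_› disj]
    simp [q, IsLocalization.AtPrime.under_maximalIdeal (Localization.AtPrime q) q]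
  refine ⟨pS, hpS, eq, fun h => ?_, ⟨(IsLocalization.algEquiv P.primeCompl
    (Localization.AtPrime pS) (Localization.AtPrime P)).toRingEquiv⟩⟩
  change P.map (algebraMap R[X] S) = _
  have h1 : P.map (algebraMap R[X] S) = (q.map C).map (algebraMap R[X] S) := congrArg _ h
  rw [h1, ← Localization.AtPrime.map_eq_maximalIdeal, Ideal.map_map, Ideal.map_map]
  exact congrArg (fun f => Ideal.map f q) (RingHom.ext fun r => Polynomial.map_C _)

section

variable {R : Type u} [CommRing R] [IsNoetherianRing R] (P : Ideal R[X]) [P.IsPrime]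
  (p : Ideal R) [p.IsPrime]

theorem SerreLocal.localization_polynomial_of_comap {i : ℕ}
    (h : SerreLocal i (Localization.AtPrime p)) (hp : P.comap C = p) :
    SerreLocal i (Localization.AtPrime P) := by
  obtain ⟨Q, hQ, hQC, -, ⟨e⟩⟩ := exists_localization_polynomial_equiv P p hp
  exact (h.localization_polynomial Q hQC).of_ringEquiv e

theorem SerreLocal.localization_of_localization_map_C {i : ℕ}
    (h : SerreLocal i (Localization.AtPrime P)) (hp : P = p.map C) :
    SerreLocal i (Localization.AtPrime p) := by
  obtain ⟨Q, hQ, -, hQm, ⟨e⟩⟩ := exists_localization_polynomial_equiv P p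
    (by rw [hp, comap_C_map_C])
  exact SerreLocal.of_localization_map_C Q (hQm hp) (h.of_ringEquiv e.symm)

omit [IsNoetherianRing R] in
theorem IsRegularLocalRing.localization_polynomial_of_comap
    [IsRegularLocalRing (Localization.AtPrime p)] (hp : P.comap C = p) :
    IsRegularLocalRing (Localization.AtPrime P) := by
  obtain ⟨Q, hQ, hQC, -, ⟨e⟩⟩ := exists_localization_polynomial_equiv P p hp
  have := Polynomial.isRegularLocalRing_localization_atPrime_of_comap_eq_maximalIdeal _ Q hQC
  exact IsRegularLocalRing.of_ringEquiv (R := Localization.AtPrime Q) e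

theorem IsRegularLocalRing.localization_of_localization_map_C
    [IsRegularLocalRing (Localization.AtPrime P)] (hp : P = p.map C) :
    IsRegularLocalRing (Localization.AtPrime p) := by
  obtain ⟨Q, hQ, -, hQm, ⟨e⟩⟩ := exists_localization_polynomial_equiv P p
    (by rw [hp, comap_C_map_C])
  have := IsRegularLocalRing.of_ringEquiv (R := Localization.AtPrime P)
    (R' := Localization.AtPrime Q) e.symm
  exact IsRegularLocalRing.of_localization_map_C Q (hQm hp)

end

end

/-! ### The extended Rees algebra: generators, finiteness and its quotient by `t⁻¹`. -/

section

open scoped DirectSum LaurentPolynomial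

namespace extendedReesAlgebra

variable {R : Type u} [CommRing R] {I : Ideal R}

theorem single_mem {n : ℤ} {r : R} (hr : r ∈ I ^ n.toNat) :
    (.single n r : R[T;T⁻¹]) ∈ extendedReesAlgebra I := by
  classical
  intro m
  rw [AddMonoidAlgebra.coeff_single, Finsupp.single_apply]
  split_ifs with h
  · exact h ▸ hr
  · exact zero_mem _

variable (I) in
/-- The element `r t ^ n` of the extended Rees algebra, for `r ∈ I ^ n`. -/
noncomputable def single (n : ℤ) (r : R) (hr : r ∈ I ^ n.toNat) : extendedReesAlgebra I :=
  ⟨.single n r, single_mem hr⟩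

@[simp] theorem coe_single (n : ℤ) (r : R) (hr : r ∈ I ^ n.toNat) :
    (single I n r hr : R[T;T⁻¹]) = .single n r := rfl

variable (I) in
/-- The element `t⁻¹` of the extended Rees algebra. -/
noncomputable def tInv : extendedReesAlgebra I :=
  single I (-1) 1 (by simp)

@[simp] theorem coe_tInv : (tInv I : R[T;T⁻¹]) = LaurentPolynomial.T (-1) := rfl

theorem coeff_mem (f : extendedReesAlgebra I) (n : ℤ) :
    (f : R[T;T⁻¹]).coeff n ∈ I ^ n.toNat := f.2 n

theorem eq_sum_single (f : extendedReesAlgebra I) :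
    f = ∑ n ∈ (f : R[T;T⁻¹]).coeff.support, single I n _ (coeff_mem f n) := by
  apply Subtype.ext
  rw [AddSubmonoidClass.coe_finsetSum]
  exact (AddMonoidAlgebra.sum_coeff_single (f : R[T;T⁻¹])).symm

theorem induction_single {motive : extendedReesAlgebra I → Prop} (f : extendedReesAlgebra I)
    (zero : motive 0) (add : ∀ f g, motive f → motive g → motive (f + g))
    (single : ∀ n r hr, motive (single I n r hr)) : motive f := by
  rw [eq_sum_single f]
  exact Finset.sum_induction _ _ add zero fun _ _ => single _ _ _

theorem single_mul_single (m n : ℤ) (r s : R) (hr : r ∈ I ^ m.toNat) (hs : s ∈ I ^ n.toNat) :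
    ∃ h, single I m r hr * single I n s hs = single I (m + n) (r * s) h := by
  have e : (.single m r : R[T;T⁻¹]) * .single n s = .single (m + n) (r * s) :=
    AddMonoidAlgebra.single_mul_single ..
  refine ⟨?_, Subtype.ext e⟩
  have := coeff_mem (single I m r hr * single I n s hs) (m + n)
  rwa [Subalgebra.coe_mul, coe_single, coe_single, e, AddMonoidAlgebra.coeff_single,
    Finsupp.single_eq_same] at this

theorem coeff_tInv_mul (f : extendedReesAlgebra I) (n : ℤ) :
    ((tInv I * f : extendedReesAlgebra I) : R[T;T⁻¹]).coeff n = (f : R[T;T⁻¹]).coeff (n + 1) := by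
  change ((.single (-1) 1 : R[T;T⁻¹]) * (f : R[T;T⁻¹])).coeff n = _
  rw [AddMonoidAlgebra.coeff_single_mul_apply, one_mul]
  congr 1
  ring

theorem isSMulRegular_tInv : IsSMulRegular (extendedReesAlgebra I) (tInv I) := by
  intro f g h
  apply Subtype.ext
  ext n
  have := congrArg (fun x : extendedReesAlgebra I => (x : R[T;T⁻¹]).coeff (n - 1)) h
  simpa only [smul_eq_mul, coeff_tInv_mul, sub_add_cancel] using this

/-- The only candidate for the quotient of `f` by `t⁻¹` is `t f`; the condition says that it still
lies in the algebra, with negative degrees imposing nothing. -/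
theorem mem_span_tInv {f : extendedReesAlgebra I} :
    f ∈ Ideal.span {tInv I} ↔ ∀ n : ℕ, (f : R[T;T⁻¹]).coeff n ∈ I ^ (n + 1) := by
  rw [Ideal.mem_span_singleton]
  constructor
  · rintro ⟨g, rfl⟩ n
    rw [coeff_tInv_mul]
    exact coeff_mem g (n + 1 : ℕ)
  · intro h
    have hc (n : ℤ) : ((.single 1 1 : R[T;T⁻¹]) * (f : R[T;T⁻¹])).coeff n
        = (f : R[T;T⁻¹]).coeff (n - 1) := by
      rw [AddMonoidAlgebra.coeff_single_mul_apply, one_mul]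
      congr 1
      ring
    refine ⟨⟨.single 1 1 * (f : R[T;T⁻¹]), fun n => ?_⟩, ?_⟩
    · rw [hc]
      obtain hn | hn := le_or_gt n 0
      · simp [Int.toNat_of_nonpos hn]
      · obtain ⟨k, rfl⟩ : ∃ k : ℕ, n = k + 1 := ⟨(n - 1).toNat, by omega⟩
        simpa using h k
    · apply Subtype.ext
      ext n
      rw [coeff_tInv_mul, hc, add_sub_cancel_right]

/-- A cross term in degree zero pairs degrees `m` and `-m` with `m ≠ 0`; the factor of positive
degree has its coefficient in `I`. This makes `coeffZeroIdeal` an ideal, and a prime one. -/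
theorem coeff_zero_mul_sub_mem (f g : extendedReesAlgebra I) :
    ((f * g : extendedReesAlgebra I) : R[T;T⁻¹]).coeff 0
      - (f : R[T;T⁻¹]).coeff 0 * (g : R[T;T⁻¹]).coeff 0 ∈ I := by
  induction f using induction_single with
  | zero => simp
  | add f f' hf hf' =>
    convert add_mem hf hf' using 1
    simp [add_mul]
    ring
  | single m r hr =>
    rw [Subalgebra.coe_mul, coe_single, AddMonoidAlgebra.coeff_single_mul_apply,
      AddMonoidAlgebra.coeff_single, add_zero, Finsupp.single_apply]
    split_ifs with h
    · simp [h]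
    · rw [zero_mul, sub_zero]
      obtain hm | hm := lt_or_gt_of_ne h
      · refine I.mul_mem_left _ (Ideal.pow_le_self ?_ (coeff_mem g _))
        omega
      · refine I.mul_mem_right _ (Ideal.pow_le_self ?_ hr)
        omega

/-! ### Finite generation -/

theorem fg (hI : I.FG) : (extendedReesAlgebra I).FG := by
  classical
  obtain ⟨s, hs⟩ := hI
  refine ⟨insert (LaurentPolynomial.T (-1)) (s.image fun a => .single 1 a), le_antisymm ?_ ?_⟩
  · refine Algebra.adjoin_le fun x hx => ?_
    rw [Finset.mem_coe, Finset.mem_insert, Finset.mem_image] at hx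
    obtain rfl | ⟨a, ha, rfl⟩ := hx
    · exact (tInv I).2
    · exact single_mem (by simpa [← hs] using Ideal.subset_span ha)
  · set A := Algebra.adjoin R ((insert (LaurentPolynomial.T (-1))
      (s.image fun a => .single 1 a) : Finset R[T;T⁻¹]) : Set R[T;T⁻¹]) with hA
    have hC (r : R) : (.single 0 r : R[T;T⁻¹]) ∈ A := A.algebraMap_mem r
    have h1 : ∀ r ∈ I, (.single 1 r : R[T;T⁻¹]) ∈ A := by
      intro r hr
      rw [← hs] at hr
      induction hr using Submodule.span_induction with
      | mem x hx =>
        refine Algebra.subset_adjoin ?_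
        rw [Finset.mem_coe, Finset.mem_insert, Finset.mem_image]
        exact Or.inr ⟨x, hx, rfl⟩
      | zero => simp
      | add x y _ _ hx hy =>
        rw [AddMonoidAlgebra.single_add]
        exact add_mem hx hy
      | smul a x _ hx =>
        have : (.single 1 (a • x) : R[T;T⁻¹]) = .single 0 a * .single 1 x := by
          rw [AddMonoidAlgebra.single_mul_single, zero_add, smul_eq_mul]
        rw [this]
        exact mul_mem (hC a) hx
    have hpos (n : ℕ) : ∀ r ∈ I ^ n, (.single n r : R[T;T⁻¹]) ∈ A := by
      induction n with
      | zero => exact fun r _ => hC r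
      | succ n ih =>
        intro r hr
        rw [pow_succ] at hr
        refine Submodule.mul_induction_on hr (fun a ha b hb => ?_) fun x y hx hy => ?_
        · have : (.single ((n + 1 : ℕ) : ℤ) (a * b) : R[T;T⁻¹]) = .single n a * .single 1 b := by
            rw [AddMonoidAlgebra.single_mul_single, Nat.cast_succ]
          rw [this]
          exact mul_mem (ih a ha) (h1 b hb)
        · rw [AddMonoidAlgebra.single_add]
          exact add_mem hx hy
    have hneg (n : ℕ) (r : R) : (.single (-n) r : R[T;T⁻¹]) ∈ A := by
      have : (.single (-n : ℤ) r : R[T;T⁻¹]) = .single 0 r * LaurentPolynomial.T (-1) ^ n := by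
        rw [LaurentPolynomial.T_pow, LaurentPolynomial.T, AddMonoidAlgebra.single_mul_single]
        simp
      rw [this]
      refine mul_mem (hC r) (pow_mem (Algebra.subset_adjoin ?_) n)
      rw [Finset.mem_coe]
      exact Finset.mem_insert_self _ _
    intro f hf
    rw [← AddMonoidAlgebra.sum_coeff_single f]
    refine sum_mem fun n _ => ?_
    obtain ⟨k, rfl | rfl⟩ := n.eq_nat_or_neg
    · exact hpos k _ (hf k)
    · exact hneg k _

instance finiteType [IsNoetherianRing R] : Algebra.FiniteType R (extendedReesAlgebra I) :=
  ⟨(extendedReesAlgebra I).fg_top.mpr (fg (IsNoetherian.noetherian I))⟩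

instance isNoetherianRing [IsNoetherianRing R] : IsNoetherianRing (extendedReesAlgebra I) :=
  Algebra.FiniteType.isNoetherianRing R _

/-! ### The associated graded ring as a quotient -/

open AssocGraded

/-- The map `R[It, t⁻¹] → gr_I(R)` on the underlying types. -/
noncomputable def toAssocGradedFun (f : extendedReesAlgebra I) : AssociatedGradedRing I :=
  -- `Int.toNat` sends negative exponents to the index `0`. At most this adds a superfluous index,
  -- since each entry is computed from the coefficient in its own degree.
  DirectSum.mk (Piece I) ((f : R[T;T⁻¹]).coeff.support.image Int.toNat)
    fun n => cls I n ⟨_, coeff_mem f (n : ℕ)⟩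

theorem toAssocGradedFun_apply (f : extendedReesAlgebra I) (n : ℕ) :
    toAssocGradedFun f n = cls I n ⟨_, coeff_mem f (n : ℕ)⟩ := by
  by_cases hn : n ∈ (f : R[T;T⁻¹]).coeff.support.image Int.toNat
  · exact DirectSum.mk_apply_of_mem hn
  · refine (DirectSum.mk_apply_of_notMem hn).trans ?_
    symm
    rw [← map_zero (cls I n)]
    congr 1
    refine Subtype.ext ?_
    by_contra h
    exact hn (Finset.mem_image.mpr ⟨n, Finsupp.mem_support_iff.mpr h, Int.toNat_natCast n⟩)

variable (I) in
/-- The map `R[It, t⁻¹] → gr_I(R)` on the underlying additive groups. -/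
noncomputable def toAssocGradedAddHom : extendedReesAlgebra I →+ AssociatedGradedRing I where
  toFun := toAssocGradedFun
  map_zero' := by
    ext n : 1
    rw [toAssocGradedFun_apply, DirectSum.zero_apply, ← map_zero (cls I n)]
    congr 1
  map_add' f g := by
    ext n : 1
    rw [toAssocGradedFun_apply, DirectSum.add_apply, toAssocGradedFun_apply,
      toAssocGradedFun_apply, ← map_add (cls I n)]
    congr 1

theorem toAssocGradedAddHom_apply (f : extendedReesAlgebra I) (n : ℕ) :
    toAssocGradedAddHom I f n = cls I n ⟨_, coeff_mem f (n : ℕ)⟩ := toAssocGradedFun_apply f n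

theorem toAssocGradedAddHom_eq_zero {f : extendedReesAlgebra I} :
    toAssocGradedAddHom I f = 0 ↔ f ∈ Ideal.span {tInv I} := by
  rw [mem_span_tInv, DirectSum.ext_iff]
  refine forall_congr' fun n => ?_
  rw [toAssocGradedAddHom_apply, DirectSum.zero_apply, Submodule.mkQ_apply,
    Submodule.Quotient.mk_eq_zero]
  rfl

theorem toAssocGradedAddHom_single (n : ℕ) (r : R) (hr : r ∈ I ^ (n : ℤ).toNat) :
    toAssocGradedAddHom I (single I n r hr) = DirectSum.of (Piece I) n (cls I n ⟨r, hr⟩) := by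
  ext k : 1
  rw [toAssocGradedAddHom_apply]
  obtain rfl | hk := eq_or_ne k n
  · rw [DirectSum.of_eq_same]
    congr 1
    refine Subtype.ext ?_
    change (AddMonoidAlgebra.single (k : ℤ) r).coeff (k : ℤ) = r
    rw [AddMonoidAlgebra.coeff_single, Finsupp.single_eq_same]
  · rw [DirectSum.of_eq_of_ne _ _ _ hk, ← map_zero (cls I k)]
    congr 1
    refine Subtype.ext ?_
    change (AddMonoidAlgebra.single (n : ℤ) r).coeff (k : ℤ) = 0
    rw [AddMonoidAlgebra.coeff_single, Finsupp.single_eq_of_ne (by exact_mod_cast hk)]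

theorem single_mem_span_tInv {n : ℤ} (hn : n < 0) (r : R) (hr : r ∈ I ^ n.toNat) :
    single I n r hr ∈ Ideal.span {tInv I} := by
  rw [mem_span_tInv]
  intro k
  rw [coe_single, AddMonoidAlgebra.coeff_single, Finsupp.single_eq_of_ne (by omega)]
  exact zero_mem _

theorem toAssocGradedAddHom_mul (f g : extendedReesAlgebra I) :
    toAssocGradedAddHom I (f * g) = toAssocGradedAddHom I f * toAssocGradedAddHom I g := by
  induction f using induction_single with
  | zero => simp
  | add f f' hf hf' =>
    rw [add_mul, map_add, hf, hf', map_add]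
    exact ((inferInstance : CommRing (AssociatedGradedRing I)).right_distrib _ _ _).symm
  | single m r hr =>
    -- The zero set is already identified with an ideal, so a factor of negative degree makes both
    -- sides vanish.
    obtain hm | hm := lt_or_ge m 0
    · have h := single_mem_span_tInv hm r hr
      rw [toAssocGradedAddHom_eq_zero.mpr h, zero_mul,
        toAssocGradedAddHom_eq_zero.mpr (Ideal.mul_mem_right _ _ h)]
    induction g using induction_single with
    | zero => simp
    | add f f' hf hf' =>
      rw [mul_add, map_add, hf, hf', map_add]
      exact ((inferInstance : CommRing (AssociatedGradedRing I)).left_distrib _ _ _).symm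
    | single n s hs =>
      obtain hn | hn := lt_or_ge n 0
      · have h := single_mem_span_tInv hn s hs
        rw [toAssocGradedAddHom_eq_zero.mpr h, mul_zero,
          toAssocGradedAddHom_eq_zero.mpr (Ideal.mul_mem_left _ _ h)]
      lift m to ℕ using hm
      lift n to ℕ using hn
      obtain ⟨h, e⟩ := single_mul_single m n r s hr hs
      rw [e, toAssocGradedAddHom_single m, toAssocGradedAddHom_single n, DirectSum.of_mul_of]
      exact toAssocGradedAddHom_single (m + n) (r * s) h

variable (I) in
/-- The ring homomorphism `R[It, t⁻¹] → gr_I(R)`. -/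
noncomputable def toAssocGraded : extendedReesAlgebra I →+* AssociatedGradedRing I where
  __ := toAssocGradedAddHom I
  map_one' := by
    have : (1 : extendedReesAlgebra I) = single I (0 : ℕ) 1 (by simp) := Subtype.ext rfl
    change toAssocGradedAddHom I 1 = 1
    rw [this, toAssocGradedAddHom_single]
    rfl
  map_mul' := toAssocGradedAddHom_mul

theorem ker_toAssocGraded : RingHom.ker (toAssocGraded I) = Ideal.span {tInv I} :=
  Ideal.ext fun _ => toAssocGradedAddHom_eq_zero

theorem toAssocGraded_surjective : Function.Surjective (toAssocGraded I) := by
  intro x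
  induction x using DirectSum.induction_on with
  | zero => exact ⟨0, map_zero _⟩
  | of n x =>
    obtain ⟨⟨r, hr⟩, rfl⟩ := Submodule.mkQ_surjective _ x
    exact ⟨single I n r hr, toAssocGradedAddHom_single n r hr⟩
  | add x y hx hy =>
    obtain ⟨a, rfl⟩ := hx
    obtain ⟨b, rfl⟩ := hy
    exact ⟨a + b, map_add _ _ _⟩

end extendedReesAlgebra

end

/-! ### Inverting `t⁻¹`, and primes of the extended Rees algebra. -/

section

open scoped LaurentPolynomial
open IsLocalRing Polynomial

namespace extendedReesAlgebra

variable {R : Type u} [CommRing R] {I : Ideal R}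

theorem mul_T_coeff (f : R[T;T⁻¹]) (m n : ℤ) :
    (f * LaurentPolynomial.T m).coeff n = f.coeff (n - m) := by
  rw [LaurentPolynomial.T, AddMonoidAlgebra.coeff_mul_single_apply, mul_one, sub_eq_add_neg]

instance isLocalization_away : IsLocalization.Away (tInv I) R[T;T⁻¹] := by
  refine IsLocalization.Away.mk (tInv I) (LaurentPolynomial.isUnit_T (-1)) (fun f => ?_)
    fun f g h => ⟨0, by rw [Subtype.ext h]⟩
  obtain ⟨N, hN⟩ : ∃ N : ℕ, ∀ n ∈ f.coeff.support, n ≤ N := by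
    obtain ⟨b, hb⟩ := f.coeff.support.bddAbove
    exact ⟨b.toNat, fun n hn => (hb hn).trans (Int.self_le_toNat b)⟩
  have hc (n : ℤ) : (f * LaurentPolynomial.T (-1) ^ N).coeff n = f.coeff (n + N) := by
    rw [LaurentPolynomial.T_pow, mul_T_coeff]
    congr 1
    ring
  refine ⟨N, ⟨f * LaurentPolynomial.T (-1) ^ N, fun n => ?_⟩, rfl⟩
  rw [hc]
  obtain hn | hn := le_or_gt n 0
  · simp [Int.toNat_of_nonpos hn]
  · rw [Finsupp.notMem_support_iff.mp fun h => by have := hN _ h; omega]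
    exact zero_mem _

/-! ### Ideals defined by conditions on coefficients -/

/-- The Laurent polynomials with all coefficients in `p`. -/
noncomputable def laurentIdeal (p : Ideal R) : Ideal R[T;T⁻¹] :=
  RingHom.ker (AddMonoidAlgebra.mapRingHom ℤ (Ideal.Quotient.mk p))

theorem mem_laurentIdeal {p : Ideal R} {f : R[T;T⁻¹]} :
    f ∈ laurentIdeal p ↔ ∀ n, f.coeff n ∈ p := by
  rw [laurentIdeal, RingHom.mem_ker]
  refine ⟨fun h n => ?_, fun h => ?_⟩
  · rw [← Ideal.Quotient.eq_zero_iff_mem, ← AddMonoidAlgebra.coeff_mapRingHom, h]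
    rfl
  · ext n
    rw [AddMonoidAlgebra.coeff_mapRingHom, Ideal.Quotient.eq_zero_iff_mem.mpr (h n)]
    rfl

instance laurentIdeal_isPrime (p : Ideal R) [p.IsPrime] : (laurentIdeal p).IsPrime :=
  RingHom.ker_isPrime _

variable (I) in
/-- The elements of the extended Rees algebra with all coefficients in `p`. -/
noncomputable def coeffIdeal (p : Ideal R) : Ideal (extendedReesAlgebra I) :=
  (laurentIdeal p).under (extendedReesAlgebra I)

theorem mem_coeffIdeal {p : Ideal R} {f : extendedReesAlgebra I} :
    f ∈ coeffIdeal I p ↔ ∀ n, (f : R[T;T⁻¹]).coeff n ∈ p := mem_laurentIdeal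

instance coeffIdeal_isPrime (p : Ideal R) [p.IsPrime] : (coeffIdeal I p).IsPrime :=
  inferInstanceAs ((laurentIdeal p).comap _).IsPrime

theorem coeff_algebraMap (r : R) (n : ℤ) :
    ((algebraMap R (extendedReesAlgebra I) r : extendedReesAlgebra I) : R[T;T⁻¹]).coeff n
      = if n = 0 then r else 0 := LaurentPolynomial.C_apply r n

theorem under_coeffIdeal (p : Ideal R) : (coeffIdeal I p).under R = p := by
  ext r
  rw [Ideal.under_def, Ideal.mem_comap, mem_coeffIdeal]
  refine ⟨fun h => by simpa only [coeff_algebraMap, if_true] using h 0, fun h n => ?_⟩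
  rw [coeff_algebraMap]
  split_ifs
  · exact h
  · exact zero_mem _

theorem tInv_notMem_coeffIdeal (p : Ideal R) [hp : p.IsPrime] : tInv I ∉ coeffIdeal I p := by
  intro h
  have := mem_coeffIdeal.mp h (-1)
  rw [coe_tInv, LaurentPolynomial.T_apply, if_pos rfl] at this
  exact hp.ne_top ((Ideal.eq_top_iff_one _).mpr this)

theorem coeffIdeal_mono {p q : Ideal R} (h : p ≤ q) : coeffIdeal I p ≤ coeffIdeal I q :=
  fun _ hf => mem_coeffIdeal.mpr fun n => h (mem_coeffIdeal.mp hf n)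

/-- Since `t⁻¹ ∉ P`, the extension of `P` to `R[t, t⁻¹]` contracts back to `P`, and there a Laurent
polynomial with coefficients in `P ∩ R` is a sum of multiples of elements of `P`. -/
theorem coeffIdeal_under_le (P : Ideal (extendedReesAlgebra I)) [P.IsPrime] (hP : tInv I ∉ P) :
    coeffIdeal I (P.under R) ≤ P := by
  intro f hf
  have hL : (P.map (algebraMap (extendedReesAlgebra I) R[T;T⁻¹])).under
      (extendedReesAlgebra I) = P := by
    refine IsLocalization.under_map_of_isPrime_disjoint (.powers (tInv I)) _ ‹_› ?_
    exact (Ideal.disjoint_powers_iff_notMem _ (Ideal.IsPrime.isRadical ‹_›)).mpr hP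
  rw [← hL, Ideal.under_def, Ideal.mem_comap]
  change (f : R[T;T⁻¹]) ∈ _
  rw [← AddMonoidAlgebra.sum_coeff_single (f : R[T;T⁻¹])]
  refine sum_mem fun n _ => ?_
  rw [LaurentPolynomial.single_eq_C_mul_T]
  refine Ideal.mul_mem_right _ _ ?_
  exact Ideal.mem_map_of_mem (algebraMap (extendedReesAlgebra I) R[T;T⁻¹])
    (mem_coeffIdeal.mp hf n : algebraMap R (extendedReesAlgebra I) _ ∈ P)

variable (I) in
/-- The elements of the extended Rees algebra whose coefficient in degree zero is in `m`. -/
def coeffZeroIdeal (m : Ideal R) (hI : I ≤ m) : Ideal (extendedReesAlgebra I) where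
  carrier := {f | (f : R[T;T⁻¹]).coeff 0 ∈ m}
  zero_mem' := zero_mem m
  add_mem' {f g} (hf : (f : R[T;T⁻¹]).coeff 0 ∈ m) (hg : (g : R[T;T⁻¹]).coeff 0 ∈ m) :=
    add_mem hf hg
  smul_mem' f g hg := by
    have := add_mem (hI (coeff_zero_mul_sub_mem f g))
      (m.mul_mem_left ((f : R[T;T⁻¹]).coeff 0) hg)
    rwa [sub_add_cancel] at this

theorem mem_coeffZeroIdeal {m : Ideal R} {hI : I ≤ m} {f : extendedReesAlgebra I} :
    f ∈ coeffZeroIdeal I m hI ↔ (f : R[T;T⁻¹]).coeff 0 ∈ m := Iff.rfl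

instance coeffZeroIdeal_isPrime (m : Ideal R) [hm : m.IsPrime] (hI : I ≤ m) :
    (coeffZeroIdeal I m hI).IsPrime where
  ne_top' h := by
    have h1 := (Ideal.eq_top_iff_one _).mp h
    rw [mem_coeffZeroIdeal] at h1
    refine hm.ne_top ((Ideal.eq_top_iff_one _).mpr ?_)
    have h2 : ((1 : extendedReesAlgebra I) : R[T;T⁻¹]) = .single 0 1 := rfl
    rwa [h2, AddMonoidAlgebra.coeff_single, Finsupp.single_eq_same] at h1
  mem_or_mem' {f g} h := by
    have := sub_mem (mem_coeffZeroIdeal.mp h) (hI (coeff_zero_mul_sub_mem f g))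
    rw [sub_sub_cancel] at this
    exact hm.mem_or_mem this

theorem tInv_mem_coeffZeroIdeal (m : Ideal R) (hI : I ≤ m) :
    tInv I ∈ coeffZeroIdeal I m hI := by
  rw [mem_coeffZeroIdeal, coe_tInv, LaurentPolynomial.T_apply, if_neg (by omega)]
  exact zero_mem _

theorem coeffIdeal_le_coeffZeroIdeal {p m : Ideal R} (h : p ≤ m) (hI : I ≤ m) :
    coeffIdeal I p ≤ coeffZeroIdeal I m hI :=
  fun _ hf => h (mem_coeffIdeal.mp hf 0)

/-- Terms of negative degree are divisible by `t⁻¹`, and coefficients in positive degree lie in `I ≤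
m`. Thus a single element separates the two primes compared in `coeffPrime_covBy_coeffZeroPrime`. -/
theorem coeffZeroIdeal_eq_sup (m : Ideal R) (hI : I ≤ m) :
    coeffZeroIdeal I m hI = coeffIdeal I m ⊔ Ideal.span {tInv I} := by
  refine le_antisymm (fun f hf => ?_) (sup_le (coeffIdeal_le_coeffZeroIdeal le_rfl hI) ?_)
  · rw [eq_sum_single f]
    refine sum_mem fun n _ => ?_
    obtain hn | hn := lt_or_ge n 0
    · exact Ideal.mem_sup_right (single_mem_span_tInv hn _ _)
    · refine Ideal.mem_sup_left (mem_coeffIdeal.mpr fun k => ?_)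
      rw [coe_single, AddMonoidAlgebra.coeff_single, Finsupp.single_apply]
      split_ifs
      · obtain rfl | hn := hn.eq_or_lt
        · exact hf
        · exact hI (Ideal.pow_le_self (by omega) (coeff_mem f n))
      · exact zero_mem _
  · rw [Ideal.span_singleton_le_iff_mem]
    exact tInv_mem_coeffZeroIdeal m hI

/-! ### Localizations at primes not containing `t⁻¹` -/

theorem coeff_toLaurent_natCast (f : R[X]) (n : ℕ) :
    (toLaurent f).coeff (n : ℤ) = f.coeff n := by
  rw [LaurentPolynomial.coeff_toLaurent]
  exact Finsupp.mapDomain_apply Nat.castEmbedding.injective _ n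

/-- Both `R[It, t⁻¹]` and `R[X]` localize to `R[t, t⁻¹]`, so the local ring at a prime avoiding
`t⁻¹` can be computed from either. -/
theorem exists_localization_equiv (P : Ideal (extendedReesAlgebra I)) [P.IsPrime]
    (hP : tInv I ∉ P) :
    ∃ (Q : Ideal R[X]) (_ : Q.IsPrime), Q.comap C = P.under R ∧
      (∀ p, P = coeffIdeal I p → Q = p.map C) ∧
      Nonempty (Localization.AtPrime Q ≃+* Localization.AtPrime P) := by
  let P' := P.map (algebraMap (extendedReesAlgebra I) R[T;T⁻¹])
  have disj : Disjoint (Submonoid.powers (tInv I) : Set (extendedReesAlgebra I)) P :=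
    (Ideal.disjoint_powers_iff_notMem _ (Ideal.IsPrime.isRadical ‹_›)).mpr hP
  have hP' : P'.IsPrime := IsLocalization.isPrime_of_isPrime_disjoint (.powers (tInv I)) _ _ ‹_› disj
  have hunder : P'.comap (algebraMap (extendedReesAlgebra I) R[T;T⁻¹]) = P :=
    IsLocalization.under_map_of_isPrime_disjoint (.powers (tInv I)) _ ‹_› disj
  have h1 : IsLocalization.AtPrime (Localization.AtPrime P') P := by
    convert IsLocalization.isLocalization_isLocalization_atPrime_isLocalization
      (.powers (tInv I)) (Localization.AtPrime P') P'
    exact hunder.symm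
  have h2 := IsLocalization.isLocalization_isLocalization_atPrime_isLocalization
      (.powers (X : R[X])) (Localization.AtPrime P') P'
  let Q := P'.comap (algebraMap R[X] R[T;T⁻¹])
  refine ⟨Q, inferInstance, ?_, fun p hp => ?_, ⟨?_⟩⟩
  · rw [← hunder, Ideal.under_def, Ideal.comap_comap, Ideal.comap_comap]
    exact congrArg (Ideal.comap · P') (RingHom.ext fun r => Polynomial.toLaurent_C r)
  · have : P' = laurentIdeal p := by
      rw [← IsLocalization.map_under (.powers (tInv I)) R[T;T⁻¹] (laurentIdeal p)]
      exact congrArg (Ideal.map (algebraMap (extendedReesAlgebra I) R[T;T⁻¹])) hp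
    ext f
    rw [Ideal.mem_comap, this, mem_laurentIdeal, Ideal.mem_map_C_iff]
    rw [LaurentPolynomial.algebraMap_eq_toLaurent]
    refine ⟨fun h n => by simpa only [coeff_toLaurent_natCast] using h n, fun h n => ?_⟩
    by_cases hn : 0 ≤ n
    · lift n to ℕ using hn
      rw [coeff_toLaurent_natCast]
      exact h n
    · rw [LaurentPolynomial.coeff_toLaurent, Finsupp.mapDomain_of_notMem_range]
      · exact zero_mem _
      · rintro ⟨k, rfl⟩
        exact hn (Int.natCast_nonneg k)
  · exact (IsLocalization.algEquiv Q.primeCompl (Localization.AtPrime Q)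
      (Localization.AtPrime P')).toRingEquiv.trans (IsLocalization.algEquiv P.primeCompl
      (Localization.AtPrime P') (Localization.AtPrime P)).toRingEquiv

end extendedReesAlgebra

end

/-! ### Saturated chains and the height bound. -/

section

open scoped LaurentPolynomial
open IsLocalRing

section CovChain

variable {α β : Type*} [PartialOrder α] [PartialOrder β]

/-- There is a saturated chain of length `n` from `a` to `b`. -/
def HasSaturatedChain (n : ℕ) (a b : α) : Prop :=
  ∃ s : RelSeries {(p, q) : α × α | p ⋖ q}, s.head = a ∧ s.last = b ∧ s.length = n

theorem HasSaturatedChain.refl (a : α) : HasSaturatedChain 0 a a :=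
  ⟨RelSeries.singleton _ a, rfl, rfl, rfl⟩

theorem HasSaturatedChain.trans {m n : ℕ} {a b c : α} (h : HasSaturatedChain m a b)
    (h' : HasSaturatedChain n b c) : HasSaturatedChain (m + n) a c := by
  obtain ⟨s, rfl, rfl, rfl⟩ := h
  obtain ⟨t, ht, rfl, rfl⟩ := h'
  exact ⟨s.smash t ht.symm, RelSeries.head_smash _, RelSeries.last_smash _, rfl⟩

theorem CovBy.hasSaturatedChain {a b : α} (h : a ⋖ b) : HasSaturatedChain 1 a b :=
  ⟨(RelSeries.singleton _ b).cons a h, rfl, RelSeries.last_cons _ _ _, rfl⟩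

theorem HasSaturatedChain.map {n : ℕ} {a b : α} (h : HasSaturatedChain n a b) (f : α → β)
    (hf : ∀ x y, x ⋖ y → f x ⋖ f y) : HasSaturatedChain n (f a) (f b) := by
  obtain ⟨s, rfl, rfl, rfl⟩ := h
  exact ⟨s.map ⟨f, fun h => hf _ _ h⟩, rfl, rfl, rfl⟩

theorem exists_hasSaturatedChain_of_height {n : ℕ} {b : α} (h : Order.height b = n) :
    ∃ a, IsMin a ∧ HasSaturatedChain n a b := by
  induction n generalizing b with
  | zero => exact ⟨b, Order.height_eq_zero.mp h, .refl b⟩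
  | succ n ih =>
    obtain ⟨-, ⟨y, hyb, hy⟩, h2⟩ := Order.height_eq_coe_add_one_iff.mp h
    obtain ⟨a, ha, hc⟩ := ih hy
    refine ⟨a, ha, hc.trans (CovBy.hasSaturatedChain ⟨hyb, fun z hyz hzb => ?_⟩)⟩
    have := Order.height_add_one_le hyz |>.trans (h2 z hzb)
    rw [hy] at this
    exact absurd this (by exact_mod_cast Nat.not_succ_le_self n)

theorem exists_hasSaturatedChain_of_coheight {n : ℕ} {a : α} (h : Order.coheight a = n) :
    ∃ b, IsMax b ∧ HasSaturatedChain n a b := by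
  induction n generalizing a with
  | zero => exact ⟨a, Order.coheight_eq_zero.mp h, .refl a⟩
  | succ n ih =>
    obtain ⟨-, ⟨y, hay, hy⟩, h2⟩ := Order.coheight_eq_coe_add_one_iff.mp h
    obtain ⟨b, hb, hc⟩ := ih hy
    refine ⟨b, hb, ?_⟩
    rw [add_comm]
    refine (CovBy.hasSaturatedChain ⟨hay, fun z haz hzy => ?_⟩).trans hc
    have := Order.coheight_add_one_le hzy |>.trans (h2 z haz)
    rw [hy] at this
    exact absurd this (by exact_mod_cast Nat.not_succ_le_self n)

theorem exists_hasSaturatedChain_of_le [WellFoundedGT α] {a b : α} (hab : a ≤ b)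
    (hb : Order.height b ≠ ⊤) : ∃ n, HasSaturatedChain n a b := by
  obtain ⟨n, hn⟩ := ENat.ne_top_iff_exists.mp hb
  induction n using Nat.strong_induction_on generalizing b with
  | _ n ih =>
    obtain rfl | hlt := hab.eq_or_lt
    · exact ⟨0, .refl a⟩
    obtain ⟨c, hac, hcb⟩ := exists_le_covBy_of_lt hlt
    have hc : Order.height c < n := by
      have := Order.height_strictMono hcb.lt (lt_of_le_of_lt (Order.height_mono hcb.le) hb.lt_top)
      rwa [← hn] at this
    obtain ⟨k, hk⟩ := ENat.ne_top_iff_exists.mp (hc.trans (ENat.natCast_lt_top n)).ne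
    rw [← hk] at hc
    obtain ⟨m, hm⟩ := ih k (by exact_mod_cast hc) hac (hk ▸ ENat.natCast_ne_top k) hk
    exact ⟨m + 1, hm.trans hcb.hasSaturatedChain⟩

end CovChain

/-- Krull's principal ideal theorem: in a Noetherian ring, there is no prime strictly between `P`
and a prime minimal over `P + (a)`. -/
theorem PrimeSpectrum.covBy_of_mem_minimalPrimes {A : Type*} [CommRing A] [IsNoetherianRing A]
    {P Q : PrimeSpectrum A} {a : A} (ha : a ∉ P.asIdeal)
    (hQ : Q.asIdeal ∈ (P.asIdeal ⊔ Ideal.span {a}).minimalPrimes) : P ⋖ Q := by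
  have hle : P.asIdeal ≤ Q.asIdeal := le_sup_left.trans hQ.1.2
  refine ⟨lt_of_le_of_ne hle fun h => ha ?_, fun Z hPZ hZQ => ?_⟩
  · rw [h]
    exact hQ.1.2 (Ideal.mem_sup_right (Ideal.mem_span_singleton_self a))
  · have h1 := Ideal.map_height_le_one_of_mem_minimalPrimes hQ
    have key (W : PrimeSpectrum A) (hW : P.asIdeal ≤ W.asIdeal) :
        (W.asIdeal.map (Ideal.Quotient.mk P.asIdeal)).IsPrime ∧
        (W.asIdeal.map (Ideal.Quotient.mk P.asIdeal)).comap (Ideal.Quotient.mk P.asIdeal)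
          = W.asIdeal := by
      refine ⟨Ideal.map_isPrime_of_surjective Ideal.Quotient.mk_surjective (by rwa [Ideal.mk_ker]),
        ?_⟩
      rw [Ideal.comap_map_of_surjective' _ Ideal.Quotient.mk_surjective, Ideal.mk_ker]
      exact sup_eq_left.mpr hW
    have step (W W' : PrimeSpectrum A) (hW : P.asIdeal ≤ W.asIdeal) (h : W < W') :
        (W.asIdeal.map (Ideal.Quotient.mk P.asIdeal)).height + 1
          ≤ (W'.asIdeal.map (Ideal.Quotient.mk P.asIdeal)).height := by
      have h' : W.asIdeal < W'.asIdeal := h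
      obtain ⟨hp, hc⟩ := key W hW
      obtain ⟨hp', hc'⟩ := key W' (hW.trans h'.le)
      refine Ideal.height_add_one_le_of_lt_of_isPrime (lt_of_le_of_ne (Ideal.map_mono h'.le) ?_)
      intro e
      exact h'.ne (by rw [← hc, e, hc'])
    -- A prime strictly in between would give height at least two modulo `P`, against Krull's bound
    -- of one.
    have h2 := step P Z le_rfl hPZ
    have h3 := (add_le_add_left h2 1).trans ((step Z Q hPZ.le hZQ).trans h1)
    have h4 : (2 : ℕ∞) ≤ 1 := by
      refine le_trans ?_ h3
      rw [add_assoc, one_add_one_eq_two]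
      exact le_add_self
    exact absurd h4 (by decide)

namespace extendedReesAlgebra

variable {R : Type u} [CommRing R] {I : Ideal R}

variable (I) in
/-- The map `Spec R → Spec R[It, t⁻¹]` sending `p` to `p R[t, t⁻¹] ∩ R[It, t⁻¹]`. -/
noncomputable def coeffPrime (p : PrimeSpectrum R) : PrimeSpectrum (extendedReesAlgebra I) :=
  ⟨coeffIdeal I p.asIdeal, inferInstance⟩

/-- For `a` in `q` but not in `p`, the upper prime is minimal over the lower one plus `(a)`: a prime
`Z` in between avoids `t⁻¹`, contracts to `q`, and hence contains the upper prime. -/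
theorem coeffPrime_covBy [IsNoetherianRing R] {p q : PrimeSpectrum R} (h : p ⋖ q) :
    coeffPrime I p ⋖ coeffPrime I q := by
  obtain ⟨a, haq, hap⟩ := SetLike.exists_of_lt (show p.asIdeal < q.asIdeal from h.lt)
  have hmem (r : PrimeSpectrum R) :
      algebraMap R (extendedReesAlgebra I) a ∈ coeffIdeal I r.asIdeal ↔ a ∈ r.asIdeal := by
    rw [← Ideal.mem_comap, ← Ideal.under_def, under_coeffIdeal]
  refine PrimeSpectrum.covBy_of_mem_minimalPrimes (a := algebraMap R _ a)
    (fun hh => hap ((hmem p).mp hh)) ⟨⟨inferInstance, sup_le (coeffIdeal_mono h.le) ?_⟩, ?_⟩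
  · rw [Ideal.span_singleton_le_iff_mem]
    exact (hmem q).mpr haq
  · rintro Z ⟨hZ, hpZ⟩ hZq
    have hu : tInv I ∉ Z := fun hh => tInv_notMem_coeffIdeal q.asIdeal (hZq hh)
    have h1 : p.asIdeal ≤ Z.under R := by
      rw [← under_coeffIdeal (I := I) p.asIdeal]
      exact Ideal.comap_mono (le_sup_left.trans hpZ)
    have h2 : Z.under R ≤ q.asIdeal := by
      rw [← under_coeffIdeal (I := I) q.asIdeal]
      exact Ideal.comap_mono hZq
    have h3 : a ∈ Z.under R :=
      hpZ (Ideal.mem_sup_right (Ideal.mem_span_singleton_self _))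
    let W : PrimeSpectrum R := ⟨Z.under R, inferInstance⟩
    have hW : W = q := by
      refine (h.eq_or_eq (c := W) h1 h2).resolve_left fun e => hap ?_
      rw [← e]
      exact h3
    change coeffIdeal I q.asIdeal ≤ Z
    rw [← hW]
    exact coeffIdeal_under_le Z hu

/-- A minimal prime avoids the nonzerodivisor `t⁻¹`, so it contains, and by minimality equals, the
prime induced from its contraction to `R`. -/
theorem isMin_eq_coeffPrime {P : PrimeSpectrum (extendedReesAlgebra I)} (hP : IsMin P) :
    ∃ p : PrimeSpectrum R, IsMin p ∧ P = coeffPrime I p := by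
  have hreg : tInv I ∈ nonZeroDivisors (extendedReesAlgebra I) :=
    mem_nonZeroDivisors_iff_right.mpr fun x hx =>
      isSMulRegular_tInv.right_eq_zero_of_smul ((mul_comm _ _).trans hx)
  have hu : tInv I ∉ P.asIdeal := fun h =>
    notMem_nonZeroDivisors_of_mem_mem_minimalPrimes h (PrimeSpectrum.isMin_iff.mp hP) hreg
  let p : PrimeSpectrum R := ⟨P.asIdeal.under R, inferInstance⟩
  have hp : coeffPrime I p ≤ P := coeffIdeal_under_le P.asIdeal hu
  have hpP : P = coeffPrime I p := le_antisymm (hP hp) hp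
  refine ⟨p, fun q hq => ?_, hpP⟩
  have hqp : coeffPrime I q ≤ coeffPrime I p := coeffIdeal_mono hq
  have h1 : coeffPrime I q ≤ P := hqp.trans hp
  have h2 : coeffIdeal I p.asIdeal ≤ coeffIdeal I q.asIdeal := hp.trans (hP h1)
  have := Ideal.comap_mono (f := algebraMap R (extendedReesAlgebra I)) h2
  rwa [← Ideal.under_def, ← Ideal.under_def, under_coeffIdeal, under_coeffIdeal] at this

variable [IsLocalRing R]

/-- The maximal homogeneous ideal of the extended Rees algebra. -/
noncomputable def coeffZeroPrime (hI : I ≤ maximalIdeal R) :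
    PrimeSpectrum (extendedReesAlgebra I) :=
  ⟨coeffZeroIdeal I _ hI, inferInstance⟩

variable [IsNoetherianRing R]

theorem coeffPrime_covBy_coeffZeroPrime (hI : I ≤ maximalIdeal R) :
    coeffPrime I (closedPoint R) ⋖ coeffZeroPrime hI := by
  refine PrimeSpectrum.covBy_of_mem_minimalPrimes (a := tInv I) (tInv_notMem_coeffIdeal _) ?_
  change coeffZeroIdeal I _ hI ∈ (coeffIdeal I (maximalIdeal R) ⊔ _).minimalPrimes
  rw [← coeffZeroIdeal_eq_sup, Ideal.minimalPrimes_eq_subsingleton_self]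
  rfl

/-- In an equidimensional local ring, there are saturated chains of length `dim R` from every
minimal prime to the maximal ideal. -/
theorem _root_.IsEquidimensionalRing.exists_hasSaturatedChain (h : IsEquidimensionalRing R) :
    ∃ d, ∀ p : PrimeSpectrum R, IsMin p → HasSaturatedChain d p (closedPoint R) := by
  obtain ⟨d, hd⟩ : ∃ d : ℕ, ringKrullDim R = d := by
    obtain ⟨d, hd⟩ := ENat.ne_top_iff_exists.mp
      (Ideal.height_ne_top (I := maximalIdeal R) (Ideal.IsPrime.ne_top inferInstance))
    exact ⟨d, by rw [← maximalIdeal_height_eq_ringKrullDim, ← hd]; rfl⟩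
  refine ⟨d, fun p hp => ?_⟩
  have h1 : Order.coheight p = d := by
    have := h p.asIdeal (PrimeSpectrum.isMin_iff.mp hp)
    have hIci : PrimeSpectrum.zeroLocus (p.asIdeal : Set R) = Set.Ici p := Set.ext fun _ => Iff.rfl
    rw [hd, ringKrullDim_quotient, hIci, ← Order.coheight_eq_krullDim_Ici] at this
    exact WithBot.coe_injective this
  obtain ⟨b, hb, hc⟩ := exists_hasSaturatedChain_of_coheight h1
  have : b = closedPoint R := by
    have hle : b ≤ closedPoint R := IsLocalRing.le_maximalIdeal b.2.ne_top
    exact le_antisymm hle (hb hle)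
  rwa [this] at hc

/-- Equidimensionality gives each minimal prime a saturated chain of length `d + 1` to the maximal
homogeneous ideal, and catenarity forces every such chain to have this length. Compare a chain
realizing the height of `Q` with one realizing the height of `coeffIdeal I p`, prolonged by the
cover to `Q`, both continued by the same chain from `Q` upward. -/
theorem height_le_height_add_one (hequi : IsEquidimensionalRing R)
    (hcat : IsUniversallyCatenaryRing R) (hI : I ≤ maximalIdeal R) (p : Ideal R) [p.IsPrime]
    (Q : Ideal (extendedReesAlgebra I)) [Q.IsPrime]
    (hQ : Q ∈ (coeffIdeal I p ⊔ Ideal.span {tInv I}).minimalPrimes)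
    (hQM : Q ≤ coeffZeroIdeal I _ hI) : Q.height ≤ (coeffIdeal I p).height + 1 := by
  have hB : IsCatenaryRing (extendedReesAlgebra I) := hcat _ inferInstance
  obtain ⟨d, hd⟩ := hequi.exists_hasSaturatedChain
  have hmin (P : PrimeSpectrum (extendedReesAlgebra I)) (hP : IsMin P) :
      HasSaturatedChain (d + 1) P (coeffZeroPrime hI) := by
    obtain ⟨p, hp, rfl⟩ := isMin_eq_coeffPrime hP
    exact ((hd p hp).map _ fun _ _ => coeffPrime_covBy).trans
      (coeffPrime_covBy_coeffZeroPrime hI).hasSaturatedChain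
  let Q' : PrimeSpectrum (extendedReesAlgebra I) := ⟨Q, ‹_›⟩
  let p' := coeffPrime I ⟨p, ‹_›⟩
  have hcov : p' ⋖ Q' := PrimeSpectrum.covBy_of_mem_minimalPrimes (tInv_notMem_coeffIdeal p) hQ
  have hfin (P : PrimeSpectrum (extendedReesAlgebra I)) : Order.height P ≠ ⊤ := by
    rw [← PrimeSpectrum.height_eq_orderHeight]
    exact Ideal.height_ne_top P.2.ne_top
  have hunique (P : PrimeSpectrum (extendedReesAlgebra I)) (hP : IsMin P) {n : ℕ}
      (h : HasSaturatedChain n P (coeffZeroPrime hI)) : n = d + 1 := by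
    obtain ⟨s, hs, hs', rfl⟩ := h
    obtain ⟨t, ht, ht', hlen⟩ := hmin P hP
    rw [← hlen]
    exact hB s t (hs.trans ht.symm) (hs'.trans ht'.symm)
  have hwf : WellFoundedGT (PrimeSpectrum (extendedReesAlgebra I)) :=
    ⟨InvImage.wf PrimeSpectrum.asIdeal wellFounded_gt⟩
  obtain ⟨a, ha⟩ := ENat.ne_top_iff_exists.mp (hfin Q')
  obtain ⟨b, hb⟩ := ENat.ne_top_iff_exists.mp (hfin p')
  obtain ⟨P₁, hP₁, h₁⟩ := exists_hasSaturatedChain_of_height ha.symm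
  obtain ⟨P₂, hP₂, h₂⟩ := exists_hasSaturatedChain_of_height hb.symm
  obtain ⟨c, hc⟩ := exists_hasSaturatedChain_of_le (show Q' ≤ coeffZeroPrime hI from hQM) (hfin _)
  have e₁ := hunique P₁ hP₁ (h₁.trans hc)
  have e₂ := hunique P₂ hP₂ ((h₂.trans hcov.hasSaturatedChain).trans hc)
  have hab : a = b + 1 := by omega
  change Q'.asIdeal.height ≤ p'.asIdeal.height + 1
  rw [PrimeSpectrum.height_eq_orderHeight, PrimeSpectrum.height_eq_orderHeight, ← ha, ← hb, hab]
  rfl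

end extendedReesAlgebra

end

/-! ### Transfer of local properties along quotients and iterated localizations. -/

section

open scoped LaurentPolynomial
open IsLocalRing Polynomial

/-- The localization of a quotient at a prime is a quotient of the localization. -/
theorem exists_localization_surjective {A G : Type*} [CommRing A] [CommRing G] (f : A →+* G)
    (hf : Function.Surjective f) {u : A} (hker : RingHom.ker f = Ideal.span {u}) (Q : Ideal A)
    [Q.IsPrime] (hu : u ∈ Q) :
    ∃ (q : Ideal G) (_ : q.IsPrime) (g : Localization.AtPrime Q →+* Localization.AtPrime q),
      Function.Surjective g ∧ RingHom.ker g = Ideal.span {algebraMap A _ u} := by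
  have hk : RingHom.ker f ≤ Q := by rwa [hker, Ideal.span_singleton_le_iff_mem]
  have hq : (Q.map f).IsPrime := Ideal.map_isPrime_of_surjective hf hk
  have hc : (Q.map f).comap f = Q := by
    rw [Ideal.comap_map_of_surjective' _ hf, sup_eq_left.mpr hk]
  have hM : Submonoid.map f Q.primeCompl = (Q.map f).primeCompl := by
    rw [← Ideal.map_primeCompl_comap_of_surjective f hf (Q.map f)]
    congr 1
    ext x
    simp only [Ideal.mem_primeCompl_iff, hc]
  have : IsLocalization (Submonoid.map f Q.primeCompl) (Localization.AtPrime (Q.map f)) := by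
    rw [hM]
    infer_instance
  refine ⟨Q.map f, hq, IsLocalization.map _ f (Submonoid.le_comap_map Q.primeCompl),
    IsLocalization.map_surjective_of_surjective _ _ _ hf, ?_⟩
  rw [IsLocalization.ker_map (S := Localization.AtPrime Q) (Localization.AtPrime (Q.map f)) f
    (M := Q.primeCompl) rfl, hker, Ideal.map_span, Set.image_singleton]

theorem nonempty_localization_equiv_of_under_eq {A S : Type*} [CommRing A] [CommRing S]
    [Algebra A S] (M : Submonoid A) [IsLocalization M S] (p : Ideal S) [p.IsPrime] {P : Ideal A}
    [hP : P.IsPrime] (h : p.under A = P) :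
    Nonempty (Localization.AtPrime p ≃+* Localization.AtPrime P) := by
  subst h
  have : IsLocalization.AtPrime (Localization.AtPrime p) (p.under A) :=
    IsLocalization.isLocalization_isLocalization_atPrime_isLocalization M _ p
  exact ⟨(IsLocalization.algEquiv (p.under A).primeCompl (Localization.AtPrime p)
    (Localization.AtPrime (p.under A))).toRingEquiv⟩

section LocalizationLocalization

variable {A : Type u} [CommRing A] [IsNoetherianRing A] {P Q : Ideal A} [P.IsPrime] [Q.IsPrime]

omit [IsNoetherianRing A] in
theorem exists_localization_localization_equiv (h : P ≤ Q) :
    ∃ (p : Ideal (Localization.AtPrime Q)) (_ : p.IsPrime), p.under A = P ∧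
      Nonempty (Localization.AtPrime p ≃+* Localization.AtPrime P) := by
  have disj : Disjoint (Q.primeCompl : Set A) P :=
    Set.disjoint_left.mpr fun x hx hxP => hx (h hxP)
  have hp : (P.map (algebraMap A (Localization.AtPrime Q))).IsPrime :=
    IsLocalization.isPrime_of_isPrime_disjoint Q.primeCompl _ _ ‹_› disj
  have hunder : (P.map (algebraMap A (Localization.AtPrime Q))).under A = P :=
    IsLocalization.under_map_of_isPrime_disjoint Q.primeCompl _ ‹_› disj
  exact ⟨_, hp, hunder, nonempty_localization_equiv_of_under_eq Q.primeCompl _ hunder⟩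

theorem SerreLocal.localization_of_forall_eq {i : ℕ} (h : P < Q)
    (hcov : ∀ r : Ideal A, r.IsPrime → P < r → r ≤ Q → r = Q)
    (hQ : SerreLocal (i + 1) (Localization.AtPrime Q)) : SerreLocal i (Localization.AtPrime P) := by
  obtain ⟨p, hp, hunder, ⟨e⟩⟩ := exists_localization_localization_equiv h.le
  have hm : (maximalIdeal (Localization.AtPrime Q)).under A = Q :=
    Localization.AtPrime.under_maximalIdeal
  have hlt {r r' : Ideal (Localization.AtPrime Q)} (hr : r < r') : r.under A < r'.under A := by
    refine lt_of_le_of_ne (Ideal.comap_mono hr.le) fun e => hr.ne ?_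
    rw [← IsLocalization.map_under Q.primeCompl _ r, e, IsLocalization.map_under Q.primeCompl]
  refine (SerreLocal.localization_of_covBy (lt_of_le_of_ne (le_maximalIdeal hp.ne_top) ?_)
    (fun r hr hlt' => ?_) hQ (Localization.AtPrime p)).of_ringEquiv e
  · intro e
    rw [e, hm] at hunder
    exact h.ne' hunder
  · have h1 := hlt hlt'
    rw [hunder] at h1
    have h2 := hcov (r.under A) inferInstance h1
      ((Ideal.comap_mono (le_maximalIdeal hr.ne_top)).trans hm.le)
    rw [← IsLocalization.map_under Q.primeCompl _ r, h2, Localization.AtPrime.map_eq_maximalIdeal]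

omit [IsNoetherianRing A] in
theorem IsRegularLocalRing.localization_of_le (h : P ≤ Q)
    [IsRegularLocalRing (Localization.AtPrime Q)] :
    IsRegularLocalRing (Localization.AtPrime P) := by
  obtain ⟨p, hp, -, ⟨e⟩⟩ := exists_localization_localization_equiv h
  have := IsRegularLocalRing.localization (Localization.AtPrime Q) p
  exact IsRegularLocalRing.of_ringEquiv (R := Localization.AtPrime p) e

end LocalizationLocalization

section Surjective

variable {A G : Type u} [CommRing A] [IsNoetherianRing A] [CommRing G] (f : A →+* G)
  (hf : Function.Surjective f) {u : A} (hker : RingHom.ker f = Ideal.span {u})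
  (hreg : IsSMulRegular A u) (Q : Ideal A) [Q.IsPrime] (hu : u ∈ Q)

include hf hker hreg hu

theorem SatisfiesS.serreLocal_localization_of_surjective {i : ℕ} (h : SatisfiesS i G) :
    SerreLocal (i + 1) (Localization.AtPrime Q) := by
  have := isNoetherianRing_of_surjective _ _ f hf
  obtain ⟨q, hq, g, hg, hgker⟩ := exists_localization_surjective f hf hker Q hu
  exact SerreLocal.of_surjective g hg hgker
    ((IsLocalization.AtPrime.to_map_mem_maximal_iff _ Q _).mpr hu)
    (hreg.of_isLocalization _ Q.primeCompl) (satisfiesS_iff.mp h q)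

theorem SatisfiesR.isRegularLocalRing_localization_of_surjective {i : ℕ} (h : SatisfiesR i G)
    (hi : Q.height ≤ i + 1) : IsRegularLocalRing (Localization.AtPrime Q) := by
  have := isNoetherianRing_of_surjective _ _ f hf
  obtain ⟨q, hq, g, hg, hgker⟩ := exists_localization_surjective f hf hker Q hu
  have hu' := (IsLocalization.AtPrime.to_map_mem_maximal_iff (Localization.AtPrime Q) Q _).mpr hu
  have hreg' := hreg.of_isLocalization (Localization.AtPrime Q) Q.primeCompl
  have hdim := ringKrullDim_add_one_of_surjective g hg hgker hu' hreg'
  have : IsRegularLocalRing (Localization.AtPrime q) := by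
    refine h q ?_
    rw [← ENat.WithBot.add_le_add_one_right_iff, hdim,
      IsLocalization.AtPrime.ringKrullDim_eq_height Q]
    exact_mod_cast hi
  exact IsRegularLocalRing.of_surjective g hg hgker hu' hreg'

end Surjective

end

/-! ### Assembly for the extended Rees algebra. -/

section

open scoped LaurentPolynomial DirectSum
open IsLocalRing Polynomial

namespace extendedReesAlgebra

variable {R : Type u} [CommRing R] [IsNoetherianRing R] {I : Ideal R}

section TInvMem

variable (Q : Ideal (extendedReesAlgebra I)) [Q.IsPrime] (hQ : tInv I ∈ Q)

include hQ

theorem serreLocal_localization_of_tInv_mem {i : ℕ} (h : SatisfiesS i (AssociatedGradedRing I)) :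
    SerreLocal (i + 1) (Localization.AtPrime Q) :=
  @SatisfiesS.serreLocal_localization_of_surjective _ (AssociatedGradedRing I) _ _ inferInstance
    (toAssocGraded I) toAssocGraded_surjective _ ker_toAssocGraded isSMulRegular_tInv Q _ hQ i h

theorem isRegularLocalRing_localization_of_tInv_mem {i : ℕ}
    (h : SatisfiesR i (AssociatedGradedRing I)) (hi : Q.height ≤ i + 1) :
    IsRegularLocalRing (Localization.AtPrime Q) :=
  @SatisfiesR.isRegularLocalRing_localization_of_surjective _ (AssociatedGradedRing I) _ _
    inferInstance (toAssocGraded I) toAssocGraded_surjective _ ker_toAssocGraded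
    isSMulRegular_tInv Q _ hQ i h hi

end TInvMem

section TInvNotMem

variable (P : Ideal (extendedReesAlgebra I)) [P.IsPrime] (hP : tInv I ∉ P)

include hP

theorem serreLocal_localization_of_under {i : ℕ}
    (h : SerreLocal i (Localization.AtPrime (P.under R))) :
    SerreLocal i (Localization.AtPrime P) := by
  obtain ⟨Q, hQ, hQP, -, ⟨e⟩⟩ := exists_localization_equiv P hP
  exact (h.localization_polynomial_of_comap Q _ hQP).of_ringEquiv e

omit [IsNoetherianRing R] in
theorem isRegularLocalRing_localization_of_under
    [IsRegularLocalRing (Localization.AtPrime (P.under R))] :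
    IsRegularLocalRing (Localization.AtPrime P) := by
  obtain ⟨Q, hQ, hQP, -, ⟨e⟩⟩ := exists_localization_equiv P hP
  have := IsRegularLocalRing.localization_polynomial_of_comap Q _ hQP
  exact IsRegularLocalRing.of_ringEquiv (R := Localization.AtPrime Q) e

end TInvNotMem

section CoeffIdeal

variable (p : Ideal R) [p.IsPrime]

theorem serreLocal_localization_of_coeffIdeal {i : ℕ}
    (h : SerreLocal i (Localization.AtPrime (coeffIdeal I p))) :
    SerreLocal i (Localization.AtPrime p) := by
  obtain ⟨Q, hQ, -, hQp, ⟨e⟩⟩ :=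
    exists_localization_equiv (coeffIdeal I p) (tInv_notMem_coeffIdeal p)
  exact (h.of_ringEquiv e.symm).localization_of_localization_map_C Q p (hQp p rfl)

theorem isRegularLocalRing_localization_of_coeffIdeal
    [IsRegularLocalRing (Localization.AtPrime (coeffIdeal I p))] :
    IsRegularLocalRing (Localization.AtPrime p) := by
  obtain ⟨Q, hQ, -, hQp, ⟨e⟩⟩ :=
    exists_localization_equiv (coeffIdeal I p) (tInv_notMem_coeffIdeal p)
  have := IsRegularLocalRing.of_ringEquiv (R := Localization.AtPrime (coeffIdeal I p))
    (R' := Localization.AtPrime Q) e.symm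
  exact IsRegularLocalRing.localization_of_localization_map_C Q p (hQp p rfl)

end CoeffIdeal

omit [IsNoetherianRing R] in
theorem exists_minimalPrimes_le_coeffZeroIdeal [IsLocalRing R] (hI : I ≤ maximalIdeal R)
    (p : Ideal R) [hp : p.IsPrime] :
    ∃ Q ∈ (coeffIdeal I p ⊔ Ideal.span {tInv I}).minimalPrimes,
      Q ≤ coeffZeroIdeal I (maximalIdeal R) hI :=
  Ideal.exists_minimalPrimes_le (sup_le
    (coeffIdeal_le_coeffZeroIdeal (le_maximalIdeal hp.ne_top) hI)
    ((Ideal.span_singleton_le_iff_mem _).mpr (tInv_mem_coeffZeroIdeal _ hI)))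

variable [IsLocalRing R] (hI : I ≤ maximalIdeal R) {i : ℕ}

include hI

theorem satisfiesS (h : SatisfiesS i (AssociatedGradedRing I)) :
    SatisfiesS i (extendedReesAlgebra I) := by
  refine satisfiesS_iff.mpr fun P hP => ?_
  by_cases hu : tInv I ∈ P
  · exact (serreLocal_localization_of_tInv_mem P hu h).mono (Nat.le_succ i)
  -- Ascend from `R` localized at `P ∩ R`, and descend to it from the induced prime; the latter is
  -- covered by a prime containing `t⁻¹`, where the index is `i + 1`.
  · refine serreLocal_localization_of_under P hu (serreLocal_localization_of_coeffIdeal (I := I) _ ?_)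
    obtain ⟨Q, hQ, -⟩ := exists_minimalPrimes_le_coeffZeroIdeal hI (P.under R)
    have hQ' : Q.IsPrime := hQ.1.1
    have hcov := PrimeSpectrum.covBy_of_mem_minimalPrimes
      (P := coeffPrime I ⟨P.under R, inferInstance⟩) (Q := ⟨Q, hQ'⟩)
      (tInv_notMem_coeffIdeal (P.under R)) hQ
    refine SerreLocal.localization_of_forall_eq hcov.lt (fun r hr hlt hle => ?_)
      (serreLocal_localization_of_tInv_mem Q
        (hQ.1.2 (Ideal.mem_sup_right (Ideal.mem_span_singleton_self _))) h)
    by_contra hne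
    exact hcov.2 (c := ⟨r, hr⟩) hlt (show r < Q from lt_of_le_of_ne hle hne)

theorem satisfiesR (hequi : IsEquidimensionalRing R) (hcat : IsUniversallyCatenaryRing R)
    (h : SatisfiesR i (AssociatedGradedRing I)) : SatisfiesR i (extendedReesAlgebra I) := by
  intro P hP hi
  rw [IsLocalization.AtPrime.ringKrullDim_eq_height P] at hi
  replace hi : P.height ≤ i := by exact_mod_cast hi
  by_cases hu : tInv I ∈ P
  · exact isRegularLocalRing_localization_of_tInv_mem P hu h (hi.trans le_self_add)
  · obtain ⟨Q, hQ, hQM⟩ := exists_minimalPrimes_le_coeffZeroIdeal hI (P.under R)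
    have hQ' : Q.IsPrime := hQ.1.1
    -- The induced prime lies inside `P`, so its height is at most `i`. The bound `i + 1` for `Q`
    -- becomes `i` in the associated graded ring after dividing by `t⁻¹`.
    have hht : Q.height ≤ i + 1 :=
      (height_le_height_add_one hequi hcat hI (P.under R) Q hQ hQM).trans
        (add_le_add_left ((Ideal.height_mono (coeffIdeal_under_le P hu)).trans hi) 1)
    have := isRegularLocalRing_localization_of_tInv_mem Q
      (hQ.1.2 (Ideal.mem_sup_right (Ideal.mem_span_singleton_self _))) h hht
    have := IsRegularLocalRing.localization_of_le (le_sup_left.trans hQ.1.2)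
    have := isRegularLocalRing_localization_of_coeffIdeal (I := I) (P.under R)
    exact isRegularLocalRing_localization_of_under P hu

omit hI [IsLocalRing R] in
theorem satisfiesS_of_satisfiesS (h : SatisfiesS i (extendedReesAlgebra I)) : SatisfiesS i R :=
  satisfiesS_iff.mpr fun p _ =>
    serreLocal_localization_of_coeffIdeal p (satisfiesS_iff.mp h (coeffIdeal I p))

end extendedReesAlgebra

end

theorem mainTheorem4 {R : Type u} [CommRing R] [IsLocalRing R] [IsNoetherianRing R]
    (hequi : IsEquidimensionalRing R) (hcat : IsUniversallyCatenaryRing R)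
    (I : Ideal R) (hI : I ≤ IsLocalRing.maximalIdeal R) (i : ℕ) :
    (SatisfiesS i (AssociatedGradedRing I) → SatisfiesS i (extendedReesAlgebra I)) ∧
    (SatisfiesR i (AssociatedGradedRing I) → SatisfiesR i (extendedReesAlgebra I)) ∧
    (SatisfiesS i (extendedReesAlgebra I) → SatisfiesS i R) :=
  ⟨extendedReesAlgebra.satisfiesS hI, extendedReesAlgebra.satisfiesR hI hequi hcat,
    extendedReesAlgebra.satisfiesS_of_satisfiesS⟩
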